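/- Let $G$ be a finite simple graph (the lattice) with a $d$-dimensional site at each vertex, let $A$ be a set of vertices, $B$ its complement, and let $|\partial A|$ be the number of edges (bonds) between $A$ and $B$. For $\alpha\neq 1$ and positive semidefinite $\rho,\sigma$ put $$\overline D_\alpha(\rho\|\sigma)=\tfrac{1}{\alpha-1}\log\operatorname{Tr}[\rho^\alpha\sigma^{1-\alpha}],\qquad \widetilde D_\alpha(\rho\|\sigma)=\tfrac{1}{\alpha-1}\log\operatorname{Tr}\big[\big(\sigma^{\frac{1-\alpha}{2\alpha}}\rho\,\sigma^{\frac{1-\alpha}{2\alpha}}\big)^\alpha\big]$$ if $\operatorname{supp}\rho\subseteq\operatorname{supp}\sigma$, and $+\infty$ otherwise (Petz and sandwiched Rényi divergence; powers are taken on the support), and let $$D^{\mathbb M}_\alpha(\rho\|\sigma)=\sup_M \tfrac{1}{\alpha-1}\log\sum_x \operatorname{Tr}[M_x\rho]^\alpha\,\operatorname{Tr}[M_x\sigma]^{1-\alpha}$$ (measured Rényi divergence), the supremum being over all POVMs $M$ with finitely many outcomes. The corresponding mutual informations of a state $\rho_{AB}$ with marginals $\rho_A,\rho_B$ are $\overline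 I_\alpha(A:B)=\overline D_\alpha(\rho_{AB}\|\rho_A\otimes\rho_B)$, $\widetilde I_\alpha(A:B)=\widetilde D_\alpha(\rho_{AB}\|\rho_A\otimes\rho_B)$ and $I^{\mathbb M}_\alpha(A:B)=D^{\mathbb M}_\alpha(\rho_{AB}\|\rho_A\otimes\rho_B)$. Let $S_\gamma(\rho)=\frac{1}{1-\gamma}\log\operatorname{Tr}\rho^\gamma$. (i) Let $\rho_{AB}$ be a normalized projected entangled pair density operator on $G$ with a local purification of bond dimension $D$: there is a projected entangled pair state on $G$ with bond dimension $D$, with a physical and an ancilla index, each of dimension $d$, at every vertex, whose partial trace over all ancillas is $\rho_{AB}$. Then $$I^{\mathbb M}_\alpha(A:B)\le 2|\partial A|\log D\quad\text{for }\alpha\in(0,1)\cup(1,2],$$ $$\widetilde I_\alpha(A:B)\le 2|\partial A|\log D\quad\text{for }\alpha\in[1/2,1)\cup(1,2],$$ $$\overline I_\alpha(A:B)\le 2|\partial A|\log D\quad\text{for }\alpha\in(0,1)\cup(1,3/2].$$ (ii) If $\rho_{AB}=|\psi\rangle\langle\psi|$ is an arbitrary pure state of the sites of $G$, then $\widetilde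 I_\alpha(A:B)=2S_{2/\alpha-1}(\rho_A)$ for $\alpha\in(0,1)\cup(1,2)$, and $\overline I_\alpha(A:B)=2S_{3-2\alpha}(\rho_A)$ for $\alpha\in(0,1)\cup(1,3/2)$. -/

import Mathlib

open scoped Kronecker ComplexOrder

noncomputable section

namespace RenyiMI

/-! ### Powers and Rényi entropies of positive semidefinite matrices -/

/-- The real power `ρ ^ s` of a positive semidefinite matrix, taken on its support: an eigenvalue
`x > 0` becomes `x ^ s` and the eigenvalue `0` stays `0`. So negative powers are powers of the
pseudo-inverse, and the power zero is the projection onto the support. -/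
def mpow {n : Type*} [Fintype n] [DecidableEq n] (ρ : Matrix n n ℂ) (s : ℝ) : Matrix n n ℂ :=
  cfc (fun x : ℝ => if x = 0 then 0 else x ^ s) ρ

/-- The Rényi entropy `S_γ(ρ) = (1 - γ)⁻¹ log Tr[ρ ^ γ]`, for `γ ≠ 1`. -/
def renyiEntropy {n : Type*} [Fintype n] [DecidableEq n] (γ : ℝ) (ρ : Matrix n n ℂ) : ℝ :=
  (1 - γ)⁻¹ * Real.log (mpow ρ γ).trace.re

/-! ### Rényi divergences (for `α ≠ 1`) -/

/-- `supp ρ ⊆ supp σ`; for Hermitian matrices this is `ker σ ⊆ ker ρ`. -/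
def SuppLE {n : Type*} [Fintype n] (ρ σ : Matrix n n ℂ) : Prop :=
  ∀ v : n → ℂ, σ.mulVec v = 0 → ρ.mulVec v = 0

open Classical in
/-- The Petz Rényi divergence: `(α - 1)⁻¹ log Tr[ρ ^ α σ ^ (1 - α)]` if `supp ρ ⊆ supp σ`,
and `+∞` otherwise. -/
def petzDiv {n : Type*} [Fintype n] [DecidableEq n] (α : ℝ) (ρ σ : Matrix n n ℂ) : EReal :=
  if SuppLE ρ σ then
    (((α - 1)⁻¹ * Real.log (mpow ρ α * mpow σ (1 - α)).trace.re : ℝ) : EReal)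
  else ⊤

open Classical in
/-- The sandwiched Rényi divergence:
`(α - 1)⁻¹ log Tr[(σ ^ ((1 - α) / (2 α)) ρ σ ^ ((1 - α) / (2 α))) ^ α]` if `supp ρ ⊆ supp σ`,
and `+∞` otherwise. -/
def sandwichedDiv {n : Type*} [Fintype n] [DecidableEq n] (α : ℝ) (ρ σ : Matrix n n ℂ) : EReal :=
  if SuppLE ρ σ then
    (((α - 1)⁻¹ * Real.log
      (mpow (mpow σ ((1 - α) / (2 * α)) * ρ * mpow σ ((1 - α) / (2 * α))) α).trace.re : ℝ) : EReal)
  else ⊤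

/-- The classical Rényi divergence `(α - 1)⁻¹ log ∑ₓ P(x) ^ α Q(x) ^ (1 - α)`. The sum lives in
`[0, ∞]` and its logarithm in `[-∞, ∞]`: for `α > 1` an outcome with `Q(x) = 0 < P(x)`
contributes `∞`, and one with `P(x) = 0` contributes `0`. -/
def classicalDiv {X : Type*} [Fintype X] (α : ℝ) (P Q : X → ℝ) : EReal :=
  (((α - 1)⁻¹ : ℝ) : EReal) *
    ENNReal.log (∑ x, ENNReal.ofReal (P x) ^ α * ENNReal.ofReal (Q x) ^ (1 - α))

/-- A positive operator-valued measure with outcomes in `X`. -/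
structure POVM (X : Type*) [Fintype X] (n : Type*) [Fintype n] [DecidableEq n] where
  /-- the effects -/
  effect : X → Matrix n n ℂ
  posSemidef : ∀ x, (effect x).PosSemidef
  sum_eq_one : ∑ x, effect x = 1

/-- The outcome distribution `x ↦ Tr[M(x) ρ]` of the measurement `M` in the state `ρ`. -/
def POVM.prob {X : Type*} [Fintype X] {n : Type*} [Fintype n] [DecidableEq n]
    (M : POVM X n) (ρ : Matrix n n ℂ) (x : X) : ℝ :=
  (M.effect x * ρ).trace.re

/-- The measured Rényi divergence: the supremum of the classical Rényi divergences of the outcome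
distributions over all POVMs with finitely many outcomes. -/
def measuredDiv {n : Type*} [Fintype n] [DecidableEq n] (α : ℝ) (ρ σ : Matrix n n ℂ) : EReal :=
  ⨆ (k : ℕ) (M : POVM (Fin k) n), classicalDiv α (M.prob ρ) (M.prob σ)

/-! ### Marginals and mutual informations of bipartite states -/

/-- The reduced matrix on the first factor. -/
def margA {X Y : Type*} [Fintype Y] (ρ : Matrix (X × Y) (X × Y) ℂ) : Matrix X X ℂ :=
  Matrix.of fun a a' => ∑ b, ρ (a, b) (a', b)

/-- The reduced matrix on the second factor. -/
def margB {X Y : Type*} [Fintype X] (ρ : Matrix (X × Y) (X × Y) ℂ) : Matrix Y Y ℂ :=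
  Matrix.of fun b b' => ∑ a, ρ (a, b) (a, b')

/-- `D̄_α(ρ_AB ‖ ρ_A ⊗ ρ_B)`. -/
def petzMI {X Y : Type*} [Fintype X] [DecidableEq X] [Fintype Y] [DecidableEq Y]
    (α : ℝ) (ρ : Matrix (X × Y) (X × Y) ℂ) : EReal :=
  petzDiv α ρ (margA ρ ⊗ₖ margB ρ)

/-- `D̃_α(ρ_AB ‖ ρ_A ⊗ ρ_B)`. -/
def sandwichedMI {X Y : Type*} [Fintype X] [DecidableEq X] [Fintype Y] [DecidableEq Y]
    (α : ℝ) (ρ : Matrix (X × Y) (X × Y) ℂ) : EReal :=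
  sandwichedDiv α ρ (margA ρ ⊗ₖ margB ρ)

/-- The measured Rényi mutual information: the measured divergence of `ρ_AB` and `ρ_A ⊗ ρ_B`. -/
def measuredMI {X Y : Type*} [Fintype X] [DecidableEq X] [Fintype Y] [DecidableEq Y]
    (α : ℝ) (ρ : Matrix (X × Y) (X × Y) ℂ) : EReal :=
  measuredDiv α ρ (margA ρ ⊗ₖ margB ρ)

/-! ### Lattice systems: one `d`-dimensional site per vertex -/

/-- The projector `|ψ⟩⟨ψ|` (for a unit vector `ψ`). -/
def ketbra {n : Type*} (ψ : n → ℂ) : Matrix n n ℂ :=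
  Matrix.vecMulVec ψ (star ψ)

/-- A state of all the sites, seen as a bipartite state of the sites in `A` and of those
outside `A`. -/
def bipartite {V : Type*} [DecidableEq V] {d : ℕ} (A : Finset V)
    (ρ : Matrix (V → Fin d) (V → Fin d) ℂ) :
    Matrix (({v // v ∈ A} → Fin d) × ({v // v ∉ A} → Fin d))
      (({v // v ∈ A} → Fin d) × ({v // v ∉ A} → Fin d)) ℂ :=
  Matrix.reindex (Equiv.piEquivPiSubtypeProd (fun v => v ∈ A) (fun _ => Fin d))
    (Equiv.piEquivPiSubtypeProd (fun v => v ∈ A) (fun _ => Fin d)) ρ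

/-- The tensors of a projected entangled pair state on the graph `G`, with bond dimension `D` and
with physical basis states `P` at each site: at each vertex, one virtual index in `Fin D` for each
incident edge, and one physical index. -/
abbrev PEPS {V : Type*} (G : SimpleGraph V) (D : ℕ) (P : Type*) :=
  (v : V) → (G.incidenceSet v → Fin D) → P → ℂ

/-- The PEPS vector: all virtual indices are contracted along the edges of `G`. -/
def PEPS.vector {V : Type*} [Fintype V] [DecidableEq V] {G : SimpleGraph V} [DecidableRel G.Adj]
    {D : ℕ} {P : Type*} (T : PEPS G D P) (s : V → P) : ℂ :=
  ∑ b : G.edgeSet → Fin D, ∏ v, T v (fun e => b ⟨e.1, e.2.1⟩) (s v)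

/-- The partial trace over the second (ancilla) index of every site. -/
def traceAncilla {V : Type*} [Fintype V] [DecidableEq V] {d : ℕ}
    (R : Matrix (V → Fin d × Fin d) (V → Fin d × Fin d) ℂ) :
    Matrix (V → Fin d) (V → Fin d) ℂ :=
  Matrix.of fun s s' => ∑ t : V → Fin d, R (fun v => (s v, t v)) (fun v => (s' v, t v))

/-- `ρ` is a (normalized) projected entangled pair density operator with a local purification of
bond dimension `D`: there is a PEPS with bond dimension `D`, with a physical and an ancilla index
of the same dimension `d` at every site, whose partial trace over the ancillas is `ρ`. -/
structure IsLocallyPurifiedPEPDO {V : Type*} [Fintype V] [DecidableEq V] (G : SimpleGraph V)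
    [DecidableRel G.Adj] (d D : ℕ) (ρ : Matrix (V → Fin d) (V → Fin d) ℂ) : Prop where
  trace_eq_one : ρ.trace = 1
  purification : ∃ T : PEPS G D (Fin d × Fin d), ρ = traceAncilla (ketbra T.vector)

end RenyiMI

end

/-! All bounds in (i) come from one quadratic inequality, packaged as `OrderTwoBound`: with σ = ρ_A
⊗ ρ_B and r the Schmidt rank of a purification across the cut, Tr[ρZ]² ≤ r² Tr[Z√σZ√σ] for every
Hermitian Z.

For a pure state ψ one has ψ = σ^{1/4}φ, where φ is ψ with every nonzero Schmidt coefficient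
replaced by 1, so that ‖φ‖² = r. Cauchy–Schwarz between |φ⟩⟨φ| and σ^{1/4}Zσ^{1/4} then gives the
inequality (`sq_trace_ketbra_mul_le`). It descends to ρ because tracing out the ancillas can only
increase Tr[Z√σZ√σ] (`trace_map_mul_sqrt_le`). A PEPS vector factors through the values of the bonds
that cross the cut, whence r ≤ D^|∂A| (`exists_cutMatrix_vector_eq_mul`).

The choice Z = σ^{-1/2}ρσ^{-1/2} bounds the sandwiched quasi-entropy of order two by r². By
Cauchy–Schwarz, Tr[√ρ σ^{-1/2} √ρ P^{1/2}] ≤ r√(Tr P) for every P ≥ 0. Monotonicity of power means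
carries this to the other exponents (`inv_mul_log_trace_le`): P = ρ yields the Petz bound and P =
ω^α, with ω = √ρ σ^{(1-α)/α} √ρ, the sandwiched one. Observables Z = ∑ c(x) M(x) reduce the measured
divergence to a classical χ² bound.

For (ii), let M be the coefficient matrix of ψ. Any power of ρ_A ⊗ ρ_B, applied to ψ, can be moved
entirely to the first factor. It gives a vector with coefficient matrix (MM*)^t M, whose squared
norm is Tr ρ_A^{2t+1}. -/

noncomputable section

namespace RenyiMI

open Matrix

/-! ### Calculus of real powers on the support -/

section Mpow

variable {n m : Type*} [Fintype n] [DecidableEq n] [Fintype m] [DecidableEq m]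

theorem exists_spectral {A : Matrix n n ℂ} (hA : A.IsHermitian) :
    ∃ (U : Matrix n n ℂ) (x : n → ℝ), U * Uᴴ = 1 ∧ Uᴴ * U = 1 ∧
      (A.PosSemidef → ∀ i, 0 ≤ x i) ∧ (A.rank = Fintype.card {i // x i ≠ 0}) ∧
      ∀ f : ℝ → ℝ, cfc f A = U * diagonal (fun i => ((f (x i) : ℝ) : ℂ)) * Uᴴ := by
  refine ⟨hA.eigenvectorUnitary, hA.eigenvalues, ?_, ?_, fun h => h.eigenvalues_nonneg,
    hA.rank_eq_card_non_zero_eigs, fun f => ?_⟩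
  · exact Unitary.coe_mul_star_self hA.eigenvectorUnitary
  · exact Unitary.coe_star_mul_self hA.eigenvectorUnitary
  · rw [hA.cfc_eq]; rfl

/-- In an eigenbasis of `A` the hypothesis forces each entry of `Uᴴ * K` to vanish unless its two
eigenvalues agree, and on equal eigenvalues `f` agrees. Hence no continuity of `f` is needed and `K`
may be rectangular and singular. This matters because the function behind `mpow` can jump at 0. -/
theorem cfc_mul_of_mul_eq_mul_diagonal {A : Matrix n n ℂ} (hA : A.IsHermitian) (f : ℝ → ℝ)
    {K : Matrix n m ℂ} {x : m → ℝ} (h : A * K = K * diagonal (fun i => (x i : ℂ))) :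
    cfc f A * K = K * diagonal (fun i => ((f (x i) : ℝ) : ℂ)) := by
  obtain ⟨U, y, h1, h2, -, -, h3⟩ := exists_spectral hA
  have hA' : A = U * diagonal (fun i => (y i : ℂ)) * Uᴴ := by
    simpa using (cfc_id ℝ A hA).symm.trans (h3 id)
  have h4 : diagonal (fun i => (y i : ℂ)) * (Uᴴ * K) =
      (Uᴴ * K) * diagonal (fun i => (x i : ℂ)) := by
    rw [hA'] at h
    replace h := congrArg (Uᴴ * ·) h
    simpa only [← Matrix.mul_assoc, h2, Matrix.one_mul] using h
  have h5 : diagonal (fun i => ((f (y i) : ℝ) : ℂ)) * (Uᴴ * K) =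
      (Uᴴ * K) * diagonal (fun i => ((f (x i) : ℝ) : ℂ)) := by
    ext i j
    have := congrFun (congrFun h4 i) j
    rw [diagonal_mul, mul_diagonal] at this ⊢
    rcases eq_or_ne ((Uᴴ * K) i j) 0 with h0 | h0
    · rw [h0]; simp
    · rw [mul_comm] at this
      have := Complex.ofReal_injective (mul_left_cancel₀ h0 this)
      rw [this, mul_comm]
  rw [h3, Matrix.mul_assoc, Matrix.mul_assoc, h5, ← Matrix.mul_assoc, ← Matrix.mul_assoc, h1,
    Matrix.one_mul]

theorem cfc_mul_of_mul_eq_mul {A : Matrix n n ℂ} {B : Matrix m m ℂ} (hA : A.IsHermitian)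
    (hB : B.IsHermitian) (f : ℝ → ℝ) {K : Matrix n m ℂ} (h : A * K = K * B) :
    cfc f A * K = K * cfc f B := by
  obtain ⟨U, y, h1, h2, -, -, h3⟩ := exists_spectral hB
  have hB' : B = U * diagonal (fun i => (y i : ℂ)) * Uᴴ := by
    simpa using (cfc_id ℝ B hB).symm.trans (h3 id)
  have : A * (K * U) = K * U * diagonal (fun i => (y i : ℂ)) := by
    rw [← Matrix.mul_assoc, h, hB', Matrix.mul_assoc, Matrix.mul_assoc _ _ U, h2, Matrix.mul_one,
      Matrix.mul_assoc]
  have := cfc_mul_of_mul_eq_mul_diagonal hA f this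
  rw [h3, ← Matrix.mul_assoc, ← Matrix.mul_assoc, ← this, Matrix.mul_assoc, Matrix.mul_assoc K,
    h1, Matrix.mul_one]

theorem cfc_conj_diagonal (f : ℝ → ℝ) {U : Matrix n n ℂ} (h1 : U * Uᴴ = 1) (h2 : Uᴴ * U = 1)
    (x : n → ℝ) : cfc f (U * diagonal (fun i => (x i : ℂ)) * Uᴴ) =
      U * diagonal (fun i => ((f (x i) : ℝ) : ℂ)) * Uᴴ := by
  have hA : (U * diagonal (fun i => (x i : ℂ)) * Uᴴ).IsHermitian := by
    apply isHermitian_mul_mul_conjTranspose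
    ext i j
    simp only [conjTranspose_apply, diagonal_apply]
    split_ifs with h h' h' <;> simp_all
  have := cfc_mul_of_mul_eq_mul_diagonal hA f (K := U) (x := x)
    (by rw [Matrix.mul_assoc, h2, Matrix.mul_one])
  rw [← this, Matrix.mul_assoc (cfc f _), h1, Matrix.mul_one]

/-- The scalar function behind `mpow`. -/
def powFun (s x : ℝ) : ℝ := if x = 0 then 0 else x ^ s

theorem powFun_nonneg {x : ℝ} (hx : 0 ≤ x) (s : ℝ) : 0 ≤ powFun s x := by
  unfold powFun; split_ifs <;> positivity

theorem powFun_mul {x : ℝ} (hx : 0 ≤ x) (s t : ℝ) :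
    powFun s x * powFun t x = powFun (s + t) x := by
  unfold powFun
  split_ifs with h
  · simp
  · rw [Real.rpow_add (lt_of_le_of_ne hx (Ne.symm h))]

theorem powFun_mul_mul {x y : ℝ} (hx : 0 ≤ x) (hy : 0 ≤ y) (s : ℝ) :
    powFun s (x * y) = powFun s x * powFun s y := by
  unfold powFun
  split_ifs <;> simp_all [Real.mul_rpow]

theorem powFun_powFun {x : ℝ} (hx : 0 ≤ x) (s t : ℝ) :
    powFun t (powFun s x) = powFun (s * t) x := by
  unfold powFun
  by_cases h : x = 0
  · simp [h]
  · have : x ^ s ≠ 0 := (Real.rpow_pos_of_pos (lt_of_le_of_ne hx (Ne.symm h)) s).ne'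
    simp [h, this, Real.rpow_mul hx]

theorem powFun_one (x : ℝ) : powFun 1 x = x := by
  unfold powFun; split_ifs with h <;> simp [h]

/-- A simultaneous spectral form of all powers of a positive semidefinite matrix. -/
theorem exists_mpow_eq {A : Matrix n n ℂ} (hA : A.PosSemidef) :
    ∃ (U : Matrix n n ℂ) (x : n → ℝ), U * Uᴴ = 1 ∧ Uᴴ * U = 1 ∧
      (∀ i, 0 ≤ x i) ∧ (A.rank = Fintype.card {i // x i ≠ 0}) ∧
      A = U * diagonal (fun i => (x i : ℂ)) * Uᴴ ∧
      ∀ s : ℝ, mpow A s = U * diagonal (fun i => ((powFun s (x i) : ℝ) : ℂ)) * Uᴴ := by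
  obtain ⟨U, x, h1, h2, h3, h4, h5⟩ := exists_spectral hA.1
  refine ⟨U, x, h1, h2, h3 hA, h4, ?_, fun s => h5 _⟩
  simpa using (cfc_id ℝ A hA.1).symm.trans (h5 id)

theorem mpow_conj_diagonal {U : Matrix n n ℂ} (h1 : U * Uᴴ = 1) (h2 : Uᴴ * U = 1)
    (x : n → ℝ) (s : ℝ) : mpow (U * diagonal (fun i => (x i : ℂ)) * Uᴴ) s =
      U * diagonal (fun i => ((powFun s (x i) : ℝ) : ℂ)) * Uᴴ :=
  cfc_conj_diagonal _ h1 h2 x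

theorem mpow_mul {A : Matrix n n ℂ} (hA : A.PosSemidef) (s t : ℝ) :
    mpow A s * mpow A t = mpow A (s + t) := by
  obtain ⟨U, x, h1, h2, h3, h4, h5, h6⟩ := exists_mpow_eq hA
  rw [h6, h6, h6]
  calc _ = U * diagonal (fun i => ((powFun s (x i) : ℝ) : ℂ)) * (Uᴴ * U) *
        diagonal (fun i => ((powFun t (x i) : ℝ) : ℂ)) * Uᴴ := by simp only [Matrix.mul_assoc]
    _ = _ := by
      rw [h2, Matrix.mul_one, Matrix.mul_assoc U, diagonal_mul_diagonal]
      simp only [← powFun_mul (h3 _), Complex.ofReal_mul]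

theorem mpow_one {A : Matrix n n ℂ} (hA : A.PosSemidef) : mpow A 1 = A := by
  obtain ⟨U, x, h1, h2, h3, h4, h5, h6⟩ := exists_mpow_eq hA
  rw [h6]
  conv_rhs => rw [h5]
  simp only [powFun_one]

theorem posSemidef_mpow {A : Matrix n n ℂ} (hA : A.PosSemidef) (s : ℝ) :
    (mpow A s).PosSemidef := by
  obtain ⟨U, x, h1, h2, h3, h4, h5, h6⟩ := exists_mpow_eq hA
  rw [h6]
  apply PosSemidef.mul_mul_conjTranspose_same
  apply PosSemidef.diagonal
  intro i
  exact Complex.zero_le_real.2 (powFun_nonneg (h3 i) s)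

theorem mpow_conjTranspose {A : Matrix n n ℂ} (hA : A.PosSemidef) (s : ℝ) :
    (mpow A s)ᴴ = mpow A s := (posSemidef_mpow hA s).1

theorem mpow_mpow {A : Matrix n n ℂ} (hA : A.PosSemidef) (s t : ℝ) :
    mpow (mpow A s) t = mpow A (s * t) := by
  obtain ⟨U, x, h1, h2, h3, h4, h5, h6⟩ := exists_mpow_eq hA
  rw [h6, h6, mpow_conj_diagonal h1 h2]
  simp only [powFun_powFun (h3 _)]

theorem trace_mpow {A : Matrix n n ℂ} {U : Matrix n n ℂ} {x : n → ℝ} {s : ℝ} (h2 : Uᴴ * U = 1)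
    (h : mpow A s = U * diagonal (fun i => ((powFun s (x i) : ℝ) : ℂ)) * Uᴴ) :
    (mpow A s).trace = ((∑ i, powFun s (x i) : ℝ) : ℂ) := by
  rw [h, trace_mul_comm, ← Matrix.mul_assoc, h2, Matrix.one_mul, trace_diagonal]
  push_cast; rfl

theorem trace_mpow_zero {A : Matrix n n ℂ} (hA : A.PosSemidef) :
    (mpow A 0).trace = (A.rank : ℂ) := by
  obtain ⟨U, x, h1, h2, h3, h4, h5, h6⟩ := exists_mpow_eq hA
  rw [trace_mpow h2 (h6 0), h4, Fintype.card_subtype, Finset.card_filter]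
  push_cast
  refine Finset.sum_congr rfl fun i _ => ?_
  unfold powFun
  split_ifs <;> simp_all

theorem trace_mpow_pos {A : Matrix n n ℂ} (hA : A.PosSemidef) (h0 : A ≠ 0) (s : ℝ) :
    0 < (mpow A s).trace.re := by
  obtain ⟨U, x, h1, h2, h3, h4, h5, h6⟩ := exists_mpow_eq hA
  rw [trace_mpow h2 (h6 s), Complex.ofReal_re]
  have : ∃ i, x i ≠ 0 := by
    by_contra! hx
    apply h0
    rw [h5]
    simp [hx]
  obtain ⟨i, hi⟩ := this
  refine Finset.sum_pos' (fun i _ => powFun_nonneg (h3 i) s) ⟨i, Finset.mem_univ _, ?_⟩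
  rw [powFun, if_neg hi]
  exact Real.rpow_pos_of_pos (lt_of_le_of_ne (h3 i) (Ne.symm hi)) s

theorem mpow_zero_mul_self {A : Matrix n n ℂ} (hA : A.PosSemidef) : mpow A 0 * A = A := by
  conv_lhs => rw [← mpow_one hA, mpow_mpow hA]
  rw [mpow_mul hA]; simp [mpow_one hA]

theorem mpow_mul_intertwine (K : Matrix n m ℂ) (s : ℝ) :
    mpow (K * Kᴴ) s * K = K * mpow (Kᴴ * K) s :=
  cfc_mul_of_mul_eq_mul (posSemidef_self_mul_conjTranspose K).1
    (posSemidef_conjTranspose_mul_self K).1 _ (Matrix.mul_assoc _ _ _)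

/-- The support projection of `K * Kᴴ` fixes the range of `K`: with that projection as `P`, the
difference `P * K - K` times its own adjoint is zero. -/
theorem mpow_zero_mul {m : Type*} [Fintype m] (K : Matrix n m ℂ) : mpow (K * Kᴴ) 0 * K = K := by
  set P := mpow (K * Kᴴ) 0 with hP
  have h : P * (K * Kᴴ) = K * Kᴴ := mpow_zero_mul_self (posSemidef_self_mul_conjTranspose K)
  have : (P * K - K) * (P * K - K)ᴴ = 0 := by
    have e : (P * K - K) * (P * K - K)ᴴ =
      (P * (K * Kᴴ) - K * Kᴴ) * Pᴴ - (P * (K * Kᴴ) - K * Kᴴ) := by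
      rw [conjTranspose_sub, conjTranspose_mul]
      simp only [Matrix.mul_sub, Matrix.sub_mul, Matrix.mul_assoc]
    rw [e, h]; simp
  exact sub_eq_zero.1 (self_mul_conjTranspose_eq_zero.1 this)

/-- Splitting off one factor `K * Kᴴ` leaves the power `s - 1`, which passes through `K` by
intertwining. Powers on the support make this valid for every real `s`, negative or zero included.
-/
theorem trace_mpow_comm (K : Matrix n m ℂ) {s : ℝ} :
    (mpow (K * Kᴴ) s).trace = (mpow (Kᴴ * K) s).trace := by
  have hA := posSemidef_self_mul_conjTranspose K
  have hB := posSemidef_conjTranspose_mul_self K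
  have h1 : mpow (K * Kᴴ) s = (mpow (K * Kᴴ) (s - 1) * K) * Kᴴ := by
    conv_lhs => rw [← sub_add_cancel s 1, ← mpow_mul hA, mpow_one hA]
    rw [Matrix.mul_assoc]
  have h2 : mpow (Kᴴ * K) s = Kᴴ * (K * mpow (Kᴴ * K) (s - 1)) := by
    conv_lhs => rw [← sub_add_cancel s 1, add_comm, ← mpow_mul hB, mpow_one hB]
    rw [Matrix.mul_assoc]
  rw [h1, h2, mpow_mul_intertwine, trace_mul_comm]

theorem mpow_transpose {A : Matrix n n ℂ} (hA : A.PosSemidef) (s : ℝ) :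
    mpow Aᵀ s = (mpow A s)ᵀ := by
  obtain ⟨U, x, h1, h2, h3, h4, h5, h6⟩ := exists_mpow_eq hA
  have e : (Uᴴᵀ)ᴴ = Uᵀ := by ext; simp
  have h1' : Uᴴᵀ * (Uᴴᵀ)ᴴ = 1 := by rw [e, ← transpose_mul, h1, transpose_one]
  have h2' : (Uᴴᵀ)ᴴ * Uᴴᵀ = 1 := by rw [e, ← transpose_mul, h2, transpose_one]
  have := mpow_conj_diagonal h1' h2' x s
  rw [e] at this
  rw [h6]
  conv_lhs => rw [h5]
  simpa [transpose_mul, Matrix.mul_assoc] using this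

theorem mpow_kronecker {A : Matrix n n ℂ} {B : Matrix m m ℂ} (hA : A.PosSemidef)
    (hB : B.PosSemidef) (s : ℝ) : mpow (A ⊗ₖ B) s = mpow A s ⊗ₖ mpow B s := by
  obtain ⟨U, x, h1, h2, h3, h4, h5, h6⟩ := exists_mpow_eq hA
  obtain ⟨V, y, g1, g2, g3, g4, g5, g6⟩ := exists_mpow_eq hB
  have e1 : (U ⊗ₖ V) * (U ⊗ₖ V)ᴴ = 1 := by
    rw [conjTranspose_kronecker, ← mul_kronecker_mul, h1, g1, one_kronecker_one]
  have e2 : (U ⊗ₖ V)ᴴ * (U ⊗ₖ V) = 1 := by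
    rw [conjTranspose_kronecker, ← mul_kronecker_mul, h2, g2, one_kronecker_one]
  have key : ∀ a : n → ℝ, ∀ b : m → ℝ,
      (U * diagonal (fun i => (a i : ℂ)) * Uᴴ) ⊗ₖ (V * diagonal (fun i => (b i : ℂ)) * Vᴴ) =
      (U ⊗ₖ V) * diagonal (fun i : n × m => ((a i.1 * b i.2 : ℝ) : ℂ)) * (U ⊗ₖ V)ᴴ := by
    intro a b
    rw [mul_kronecker_mul, mul_kronecker_mul, diagonal_kronecker_diagonal,
      conjTranspose_kronecker]
    push_cast; rfl
  rw [h6, g6, key]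
  conv_lhs => rw [h5, g5, key]
  rw [mpow_conj_diagonal e1 e2]
  simp only [powFun_mul_mul (h3 _) (g3 _)]

end Mpow

/-! ### Monotonicity of power means -/

section Jensen

/-- Bernoulli's inequality for negative exponents: exp(t log u) ≥ 1 + t log u, and log u ≤ u - 1
reverses under multiplication by t. -/
theorem one_add_mul_le_rpow_of_neg {u t : ℝ} (hu : 0 < u) (ht : t < 0) :
    1 + t * (u - 1) ≤ u ^ t := by
  rw [Real.rpow_def_of_pos hu]
  have h1 := Real.add_one_le_exp (Real.log u * t)
  have h2 := Real.log_le_sub_one_of_pos hu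
  nlinarith

/-- Monotonicity of power means of a positive random variable, in logarithmic form. -/
theorem inv_mul_log_sum_rpow_le {ι : Type*} [Fintype ι] {w z : ι → ℝ} (hw : ∀ i, 0 ≤ w i)
    (hw1 : ∑ i, w i = 1) (hz : ∀ i, 0 < z i) {R : ℝ} (hR : ∑ i, w i * z i ≤ R) {t : ℝ}
    (ht : t < 0 ∨ 0 < t ∧ t ≤ 1) :
    0 < ∑ i, w i * z i ^ t ∧ t⁻¹ * Real.log (∑ i, w i * z i ^ t) ≤ Real.log R := by
  have hex : ∃ i, 0 < w i := by
    by_contra! h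
    have : ∑ i, w i ≤ 0 := Finset.sum_nonpos fun i _ => h i
    linarith
  obtain ⟨i₀, hi₀⟩ := hex
  have pos : ∀ y : ι → ℝ, (∀ i, 0 < y i) → 0 < ∑ i, w i * y i := fun y hy =>
    Finset.sum_pos' (fun i _ => mul_nonneg (hw i) (hy i).le)
      ⟨i₀, Finset.mem_univ _, mul_pos hi₀ (hy i₀)⟩
  have hS := pos (fun i => z i ^ t) fun i => Real.rpow_pos_of_pos (hz i) t
  have hm := pos z hz
  set m := ∑ i, w i * z i with hmdef
  set S := ∑ i, w i * z i ^ t with hSdef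
  have hlog : Real.log m ≤ Real.log R := Real.log_le_log hm hR
  -- After normalizing by the mean `m`, the tangent line of u ↦ u^t at u = 1 averages to exactly 1.
  -- It lies below the curve for t < 0 and above it for 0 < t ≤ 1, and dividing the logarithms by t
  -- gives the same final inequality in both cases.
  have e1 : ∑ i, w i * (z i / m) ^ t = S / m ^ t := by
    rw [hSdef, Finset.sum_div]
    refine Finset.sum_congr rfl fun i _ => ?_
    rw [Real.div_rpow (hz i).le hm.le, mul_div_assoc]
  have e2 : ∑ i, w i * (1 + t * (z i / m - 1)) = 1 := by
    have : ∀ i, w i * (1 + t * (z i / m - 1)) = w i * (1 - t) + (w i * z i) * (t / m) := by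
      intro i; field_simp; ring
    simp only [this, Finset.sum_add_distrib, ← Finset.sum_mul, hw1, ← hmdef]
    field_simp; ring
  have hmt : 0 < m ^ t := Real.rpow_pos_of_pos hm t
  refine ⟨hS, le_trans ?_ hlog⟩
  rcases ht with ht | ⟨ht, ht1⟩
  · have h : 1 ≤ S / m ^ t := by
      rw [← e1, ← e2]
      exact Finset.sum_le_sum fun i _ => mul_le_mul_of_nonneg_left
        (one_add_mul_le_rpow_of_neg (div_pos (hz i) hm) ht) (hw i)
    rw [one_le_div hmt] at h
    have := Real.log_le_log hmt h
    rw [Real.log_rpow hm] at this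
    rw [inv_mul_eq_div, div_le_iff_of_neg ht, mul_comm]
    exact this
  · have h : S / m ^ t ≤ 1 := by
      rw [← e1, ← e2]
      refine Finset.sum_le_sum fun i _ => mul_le_mul_of_nonneg_left ?_ (hw i)
      have h0 : -1 ≤ z i / m - 1 := by linarith [div_pos (hz i) hm]
      simpa using rpow_one_add_le_one_add_mul_self h0 ht.le ht1
    rw [div_le_one hmt] at h
    have := Real.log_le_log hS h
    rw [Real.log_rpow hm] at this
    rw [inv_mul_le_iff₀ ht]
    exact this

variable {n m : Type*} [Fintype n] [DecidableEq n] [Fintype m] [DecidableEq m]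

/-- The power means `Tr[K Q⁻ᵝ K* Pᵝ] ^ (1 / β)` increase with `β`. -/
theorem inv_mul_log_trace_le {P : Matrix n n ℂ} {Q : Matrix m m ℂ} (hP : P.PosSemidef)
    (hQ : Q.PosSemidef) (K : Matrix n m ℂ)
    (h0 : (K * mpow Q 0 * Kᴴ * mpow P 0).trace.re = 1) {R : ℝ}
    (hR : (K * mpow Q (-(1 / 2)) * Kᴴ * mpow P (1 / 2)).trace.re ≤ R) {β : ℝ}
    (hβ : β < 0 ∨ 0 < β ∧ β ≤ 1 / 2) :
    0 < (K * mpow Q (-β) * Kᴴ * mpow P β).trace.re ∧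
    β⁻¹ * Real.log (K * mpow Q (-β) * Kᴴ * mpow P β).trace.re ≤ 2 * Real.log R := by
  obtain ⟨U, x, -, -, hx, -, -, hU⟩ := exists_mpow_eq hP
  obtain ⟨V, y, -, -, hy, -, -, hV⟩ := exists_mpow_eq hQ
  -- In eigenbases of `P` and `Q` the trace is ∑ |k_ij|² y_j^{-b} x_i^b: a moment of the eigenvalue
  -- ratios, whose weights have total mass 1 by `h0`.
  set k := Uᴴ * K * V with hk
  have key : ∀ b : ℝ, (K * mpow Q (-b) * Kᴴ * mpow P b).trace.re =
      ∑ p : n × m, ‖k p.1 p.2‖ ^ 2 * (powFun (-b) (y p.2) * powFun b (x p.1)) := by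
    intro b
    have : (K * mpow Q (-b) * Kᴴ * mpow P b).trace =
        (k * diagonal (fun j => ((powFun (-b) (y j) : ℝ) : ℂ)) * kᴴ *
          diagonal (fun i => ((powFun b (x i) : ℝ) : ℂ))).trace := by
      rw [hU, hV, ← Matrix.mul_assoc, trace_mul_comm, hk]
      simp only [conjTranspose_mul, conjTranspose_conjTranspose, Matrix.mul_assoc]
    rw [this, Fintype.sum_prod_type, trace, Complex.re_sum]
    refine Finset.sum_congr rfl fun i _ => ?_
    rw [diag_apply, mul_diagonal, mul_apply, Finset.sum_mul, Complex.re_sum]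
    refine Finset.sum_congr rfl fun j _ => ?_
    rw [mul_diagonal, conjTranspose_apply]
    have : k i j * ((powFun (-b) (y j) : ℝ) : ℂ) * star (k i j) * ((powFun b (x i) : ℝ) : ℂ) =
        ((‖k i j‖ ^ 2 * (powFun (-b) (y j) * powFun b (x i)) : ℝ) : ℂ) := by
      push_cast
      rw [← Complex.mul_conj']
      simp only [RCLike.star_def]
      ring
    rw [this, Complex.ofReal_re]
  set w : n × m → ℝ := fun p => ‖k p.1 p.2‖ ^ 2 * (powFun 0 (y p.2) * powFun 0 (x p.1)) with hw
  -- The square root makes `hR` a bound on the first moment, so exponent b becomes 2b. The value 1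
  -- off the supports is harmless, since the weight vanishes there.
  set z : n × m → ℝ := fun p => if x p.1 = 0 ∨ y p.2 = 0 then 1 else (x p.1 / y p.2) ^ (1 / 2 : ℝ)
    with hz
  have key2 : ∀ b : ℝ, (K * mpow Q (-b) * Kᴴ * mpow P b).trace.re =
      ∑ p : n × m, w p * z p ^ (2 * b) := by
    intro b
    rw [key]
    refine Finset.sum_congr rfl fun p _ => ?_
    simp only [hw, hz, powFun]
    by_cases h1 : x p.1 = 0
    · simp [h1]
    by_cases h2 : y p.2 = 0
    · simp [h2]
    have h1' : 0 < x p.1 := lt_of_le_of_ne (hx _) (Ne.symm h1)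
    have h2' : 0 < y p.2 := lt_of_le_of_ne (hy _) (Ne.symm h2)
    simp only [h1, h2, or_self, if_false, Real.rpow_zero, mul_one]
    rw [← Real.rpow_mul (by positivity), show (1 / 2 : ℝ) * (2 * b) = b by ring,
      Real.div_rpow h1'.le h2'.le, Real.rpow_neg h2'.le]
    field_simp
  have hz0 : ∀ p, 0 < z p := by
    intro p
    simp only [hz]
    split_ifs with h
    · exact one_pos
    · push Not at h
      have h1' : 0 < x p.1 := lt_of_le_of_ne (hx _) (Ne.symm h.1)
      have h2' : 0 < y p.2 := lt_of_le_of_ne (hy _) (Ne.symm h.2)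
      positivity
  have hw0 : ∀ p, 0 ≤ w p := fun p =>
    mul_nonneg (by positivity) (mul_nonneg (powFun_nonneg (hy _) _) (powFun_nonneg (hx _) _))
  have hw1 : ∑ p, w p = 1 := by
    have := key2 0
    simp only [neg_zero, mul_zero, Real.rpow_zero, mul_one] at this
    rw [← this, h0]
  rw [key2] at hR
  simp only [one_div, ne_eq, OfNat.ofNat_ne_zero, not_false_eq_true, mul_inv_cancel₀,
    Real.rpow_one] at hR
  have := inv_mul_log_sum_rpow_le hw0 hw1 hz0 hR (t := 2 * β)
    (by rcases hβ with h | h <;> [left; right] <;> [linarith; constructor <;> linarith])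
  rw [key2]
  refine ⟨this.1, ?_⟩
  have h2 := this.2
  rw [mul_inv] at h2
  linarith

end Jensen

/-! ### The Hilbert–Schmidt inner product -/

section HilbertSchmidt

theorem trace_conjTranspose_mul_eq_sum {n m : Type*} [Fintype n] [Fintype m]
    (A B : Matrix n m ℂ) : (Aᴴ * B).trace = ∑ p : n × m, star (A p.1 p.2) * B p.1 p.2 := by
  rw [Fintype.sum_prod_type_right]
  simp [trace, mul_apply]

theorem trace_conjTranspose_mul_self_re {n m : Type*} [Fintype n] [Fintype m]
    (A : Matrix n m ℂ) : (Aᴴ * A).trace.re = ∑ p : n × m, ‖A p.1 p.2‖ ^ 2 := by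
  rw [trace_conjTranspose_mul_eq_sum, Complex.re_sum]
  refine Finset.sum_congr rfl fun p _ => ?_
  rw [RCLike.star_def, Complex.conj_mul', ← Complex.ofReal_pow, Complex.ofReal_re]

/-- Cauchy–Schwarz for the Hilbert–Schmidt inner product. -/
theorem norm_trace_conjTranspose_mul_sq_le {n m : Type*} [Fintype n] [Fintype m]
    (A B : Matrix n m ℂ) :
    ‖(Aᴴ * B).trace‖ ^ 2 ≤ (Aᴴ * A).trace.re * (Bᴴ * B).trace.re := by
  rw [trace_conjTranspose_mul_self_re, trace_conjTranspose_mul_self_re,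
    trace_conjTranspose_mul_eq_sum]
  have h : ‖∑ p : n × m, star (A p.1 p.2) * B p.1 p.2‖ ≤
      ∑ p : n × m, ‖A p.1 p.2‖ * ‖B p.1 p.2‖ :=
    (norm_sum_le _ _).trans_eq (Finset.sum_congr rfl fun p _ => by rw [norm_mul, norm_star])
  calc _ ≤ (∑ p : n × m, ‖A p.1 p.2‖ * ‖B p.1 p.2‖) ^ 2 := by gcongr
    _ ≤ _ := Finset.sum_mul_sq_le_sq_mul_sq _ _ _

end HilbertSchmidt

/-! ### Hermitian forms bounded by a geometric mean of weights -/

section GeometricMean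

variable {ι : Type*} [Fintype ι] [DecidableEq ι]

/-- Rescaling by `E` turns the geometric mean of the weights into the identity, so it suffices that
no eigenvalue μ of `E * G * E` exceeds 1. Testing `h` on vectors built from an eigenvector gives
(μN)² ≤ N² with N > 0. -/
theorem re_dotProduct_mulVec_le_of_pos {G : Matrix ι ι ℂ} (hG : G.IsHermitian) {l r : ι → ℝ}
    (hl : ∀ i, 0 < l i) (hr : ∀ i, 0 < r i)
    (h : ∀ x y : ι → ℂ, ‖star x ⬝ᵥ G *ᵥ y‖ ^ 2 ≤
      (∑ i, l i * ‖x i‖ ^ 2) * ∑ i, r i * ‖y i‖ ^ 2) (x : ι → ℂ) :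
    (star x ⬝ᵥ G *ᵥ x).re ≤ ∑ i, √(l i * r i) * ‖x i‖ ^ 2 := by
  set e : ι → ℝ := fun i => √(√(l i * r i)) with he
  have hd : ∀ i, 0 < √(l i * r i) := fun i => Real.sqrt_pos.2 (mul_pos (hl i) (hr i))
  have he0 : ∀ i, 0 < e i := fun i => Real.sqrt_pos.2 (hd i)
  have hee : ∀ i, e i * e i = √(l i * r i) := fun i => Real.mul_self_sqrt (hd i).le
  have heC : ∀ i, (e i : ℂ) ≠ 0 := fun i => Complex.ofReal_ne_zero.2 (he0 i).ne'
  set E : Matrix ι ι ℂ := diagonal fun i => ((e i)⁻¹ : ℂ) with hE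
  have hEH : Eᴴ = E := by
    rw [hE, diagonal_conjTranspose]
    congr 1; ext i; simp
  have hK : (1 - E * G * E).IsHermitian := by
    refine isHermitian_one.sub ?_
    have := isHermitian_mul_mul_conjTranspose E hG
    rwa [hEH] at this
  have hEmul : ∀ (v : ι → ℂ) i, (E *ᵥ v) i = (e i : ℂ)⁻¹ * v i := fun v i => by
    rw [hE, mulVec_diagonal]
  have hpsd : (1 - E * G * E).PosSemidef := by
    rw [hK.posSemidef_iff_eigenvalues_nonneg]
    intro j
    set v : ι → ℂ := (hK.eigenvectorBasis j).ofLp with hv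
    set μ : ℝ := 1 - hK.eigenvalues j with hμ
    have hv0 : v ≠ 0 := by
      intro h0
      apply hK.eigenvectorBasis.orthonormal.ne_zero j
      ext i
      exact congrFun h0 i
    have h1 := hK.mulVec_eigenvectorBasis j
    rw [← hv, sub_mulVec, one_mulVec] at h1
    have h2 : (E * G * E) *ᵥ v = (μ : ℂ) • v := by
      have h2 : (E * G * E) *ᵥ v = v - hK.eigenvalues j • v := by rw [← h1]; abel
      rw [h2]
      ext i
      simp [hμ, sub_mul]
    have h3 : ∀ i, (G *ᵥ (E *ᵥ v)) i = μ * e i * v i := by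
      intro i
      have := congrFun h2 i
      rw [← mulVec_mulVec, ← mulVec_mulVec, hEmul, Pi.smul_apply, smul_eq_mul] at this
      rw [inv_mul_eq_iff_eq_mul₀ (heC i)] at this
      rw [this]; ring
    set N := ∑ i, r i * ‖(E *ᵥ v) i‖ ^ 2 with hN
    have hN0 : 0 < N := by
      obtain ⟨i, hi⟩ := Function.ne_iff.1 hv0
      refine Finset.sum_pos' (fun i _ => mul_nonneg (hr i).le (by positivity))
        ⟨i, Finset.mem_univ _, mul_pos (hr i) ?_⟩
      rw [hEmul]
      have : (e i : ℂ)⁻¹ * v i ≠ 0 := mul_ne_zero (inv_ne_zero (heC i)) hi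
      positivity
    -- The factor √(r/l) balances the two sides: it turns the `l`-weighted norm of the first vector
    -- into the `r`-weighted norm `N` of the second, and the form takes the value μN.
    have h4 := h (fun i => (√(r i / l i) : ℂ) * (E *ᵥ v) i) (E *ᵥ v)
    have h5 : star (fun i => (√(r i / l i) : ℂ) * (E *ᵥ v) i) ⬝ᵥ G *ᵥ (E *ᵥ v) =
        ((μ * N : ℝ) : ℂ) := by
      rw [dotProduct, hN, Finset.mul_sum, Complex.ofReal_sum]
      refine Finset.sum_congr rfl fun i _ => ?_
      have a1 : √(r i / l i) * (e i * e i) = r i := by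
        rw [hee, ← Real.sqrt_mul (div_nonneg (hr i).le (hl i).le),
          show r i / l i * (l i * r i) = r i * r i by field_simp [(hl i).ne'],
          Real.sqrt_mul_self (hr i).le]
      have a2 : v i = (e i : ℂ) * (E *ᵥ v) i := by
        rw [hEmul, mul_inv_cancel_left₀ (heC i)]
      rw [h3, a2]
      push_cast
      rw [← Complex.conj_mul', ← a1]
      simp only [Pi.star_apply, star_mul', RCLike.star_def, Complex.conj_ofReal]
      push_cast
      rw [show E *ᵥ (fun _ => _) = E *ᵥ v from rfl]
      ring
    have h6 : ∑ i, l i * ‖(√(r i / l i) : ℂ) * (E *ᵥ v) i‖ ^ 2 = N := by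
      refine Finset.sum_congr rfl fun i _ => ?_
      rw [norm_mul, mul_pow, Complex.norm_real, Real.norm_eq_abs, sq_abs,
        Real.sq_sqrt (div_nonneg (hr i).le (hl i).le)]
      field_simp [(hl i).ne']
    rw [h5, h6, ← hN, Complex.norm_real, Real.norm_eq_abs, sq_abs] at h4
    have h7 : μ ≤ 1 := by
      by_contra! hc
      have : N < μ * N := by nlinarith
      nlinarith
    change (0 : ℝ) ≤ _
    linarith
  have := hpsd.re_dotProduct_nonneg (fun i => (e i : ℂ) * x i)
  have hx : E *ᵥ (fun i => (e i : ℂ) * x i) = x := by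
    ext i; rw [hEmul, inv_mul_cancel_left₀ (heC i)]
  have hs : star (fun i => (e i : ℂ) * x i) ᵥ* E = star x := by
    conv_rhs => rw [← hx]
    rw [star_mulVec, hEH]
  rw [sub_mulVec, one_mulVec, dotProduct_sub, ← mulVec_mulVec, ← mulVec_mulVec, hx,
    dotProduct_mulVec, hs, map_sub, sub_nonneg] at this
  refine this.trans_eq ?_
  rw [dotProduct, map_sum]
  refine Finset.sum_congr rfl fun i _ => ?_
  rw [← hee, Pi.star_apply, RCLike.star_def, Complex.conj_mul', norm_mul, Complex.norm_real,
    Real.norm_eq_abs, abs_of_pos (he0 i), ← Complex.ofReal_pow]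
  rw [RCLike.re_eq_complex_re, Complex.ofReal_re]
  ring

/-- A Hermitian form bounded by the two weights `l`, `r` in the sense of Cauchy–Schwarz is bounded
by their geometric mean. -/
theorem re_dotProduct_mulVec_le {G : Matrix ι ι ℂ} (hG : G.IsHermitian) {l r : ι → ℝ}
    (hl : ∀ i, 0 ≤ l i) (hr : ∀ i, 0 ≤ r i)
    (h : ∀ x y : ι → ℂ, ‖star x ⬝ᵥ G *ᵥ y‖ ^ 2 ≤
      (∑ i, l i * ‖x i‖ ^ 2) * ∑ i, r i * ‖y i‖ ^ 2) (x : ι → ℂ) :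
    (star x ⬝ᵥ G *ᵥ x).re ≤ ∑ i, √(l i * r i) * ‖x i‖ ^ 2 := by
  -- Vanishing weights are reached by adding ε > 0 to both weights and letting ε tend to 0.
  have hcont : Continuous fun ε : ℝ => ∑ i, √((l i + ε) * (r i + ε)) * ‖x i‖ ^ 2 := by
    fun_prop
  have hlim := (hcont.tendsto 0).mono_left (nhdsWithin_le_nhds (s := Set.Ioi 0))
  simp only [add_zero] at hlim
  refine ge_of_tendsto hlim ?_
  filter_upwards [self_mem_nhdsWithin] with ε hε
  have hε : 0 < ε := hε
  refine re_dotProduct_mulVec_le_of_pos hG (fun i => add_pos_of_nonneg_of_pos (hl i) hε)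
    (fun i => add_pos_of_nonneg_of_pos (hr i) hε) (fun x y => (h x y).trans ?_) x
  refine mul_le_mul ?_ ?_ ?_ ?_
  · exact Finset.sum_le_sum fun i _ => by gcongr; linarith
  · exact Finset.sum_le_sum fun i _ => by gcongr; linarith
  · exact Finset.sum_nonneg fun i _ => mul_nonneg (hr i) (by positivity)
  · exact Finset.sum_nonneg fun i _ => mul_nonneg (by linarith [hl i]) (by positivity)

end GeometricMean

/-! ### Data processing for Tr[Z√σZ√σ] -/

section DataProcessing

variable {n N : Type*} [Fintype n] [DecidableEq n] [Fintype N] [DecidableEq N]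

/-- Data processing for `Tr[Z √σ Z √σ]` under a unital embedding of matrix algebras. -/
theorem trace_map_mul_sqrt_le (E : Matrix n n ℂ →⋆ₐ[ℂ] Matrix N N ℂ) {S : Matrix N N ℂ}
    {σ : Matrix n n ℂ} (hS : S.PosSemidef) (hσ : σ.PosSemidef)
    (hE : ∀ Z, (S * E Z).trace = (σ * Z).trace) {Z : Matrix n n ℂ} (hZ : Z.IsHermitian) :
    (E Z * mpow S (1 / 2) * E Z * mpow S (1 / 2)).trace.re ≤
      (Z * mpow σ (1 / 2) * Z * mpow σ (1 / 2)).trace.re := by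
  obtain ⟨U, x, h1, h2, hx, -, hσU, hU⟩ := exists_mpow_eq hσ
  set T := mpow S (1 / 2) with hT
  have hTT : T * T = S := by
    rw [hT, mpow_mul hS]; norm_num; exact mpow_one hS
  have hTH : Tᴴ = T := mpow_conjTranspose hS _
  -- Matrices are parametrized by their entries in an eigenbasis of σ, where left and right
  -- multiplication by σ become the diagonal weights `x p.1` and `x p.2`.
  let Y : (n × n → ℂ) → Matrix n n ℂ := fun v => U * (of fun i j => v (i, j)) * Uᴴ
  let b : n × n → Matrix n n ℂ := fun p => U * single p.1 p.2 1 * Uᴴ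
  have hY : ∀ v, Y v = ∑ p, v p • b p := by
    intro v
    have : (of fun i j => v (i, j) : Matrix n n ℂ) = ∑ p : n × n, v p • single p.1 p.2 1 := by
      conv_lhs => rw [matrix_eq_sum_single (of fun i j => v (i, j))]
      rw [Fintype.sum_prod_type]
      simp
    simp only [Y, b, this, Matrix.mul_sum, Matrix.sum_mul, Matrix.mul_smul, Matrix.smul_mul]
  -- This is the Gram matrix of the form (A, B) ↦ Tr[E(A)* √S E(B) √S] in that basis.
  let G : Matrix (n × n) (n × n) ℂ := of fun p q => ((E (b p))ᴴ * T * E (b q) * T).trace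
  have hEH : ∀ W, (E W)ᴴ = E Wᴴ := fun W => (map_star E W).symm
  have hG : ∀ v w, star v ⬝ᵥ G *ᵥ w = ((E (Y v))ᴴ * T * E (Y w) * T).trace := by
    intro v w
    rw [hY, hY, map_sum, map_sum, conjTranspose_sum]
    simp only [map_smul, conjTranspose_smul, Matrix.sum_mul, Matrix.smul_mul,
      Matrix.mul_smul, trace_sum, trace_smul, dotProduct, mulVec, G, of_apply, Pi.star_apply,
      smul_eq_mul, Finset.mul_sum]
    rw [Finset.sum_comm]
    refine Finset.sum_congr rfl fun p _ => Finset.sum_congr rfl fun q _ => ?_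
    ring
  have hGH : G.IsHermitian := by
    ext p q
    simp only [conjTranspose_apply, G, of_apply]
    rw [← trace_conjTranspose]
    simp only [conjTranspose_mul, conjTranspose_conjTranspose, hTH]
    rw [trace_mul_comm]
    simp only [Matrix.mul_assoc]
  have hl : ∀ v : n × n → ℂ, (σ * (Y v * (Y v)ᴴ)).trace.re = ∑ p, x p.1 * ‖v p‖ ^ 2 := by
    intro v
    set W : Matrix n n ℂ := of fun i j => v (i, j) with hW
    have : (σ * (Y v * (Y v)ᴴ)).trace = (diagonal (fun i => (x i : ℂ)) * W * Wᴴ).trace := by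
      have : σ * (Y v * (Y v)ᴴ) = U * (diagonal (fun i => (x i : ℂ)) * (Uᴴ * U) * W *
          (Uᴴ * U) * Wᴴ * Uᴴ) := by
        conv_lhs => rw [hσU]
        simp only [Y, conjTranspose_mul, conjTranspose_conjTranspose, Matrix.mul_assoc, hW]
      rw [this, trace_mul_comm, h2]
      simp only [Matrix.mul_assoc, h2, Matrix.mul_one]
    rw [this, trace, Complex.re_sum, Fintype.sum_prod_type]
    refine Finset.sum_congr rfl fun i _ => ?_
    rw [diag_apply, mul_apply, Complex.re_sum]
    refine Finset.sum_congr rfl fun j _ => ?_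
    rw [diagonal_mul, conjTranspose_apply, mul_assoc, RCLike.star_def, Complex.mul_conj',
      ← Complex.ofReal_pow, ← Complex.ofReal_mul, Complex.ofReal_re]
    rfl
  have hr : ∀ v : n × n → ℂ, (σ * ((Y v)ᴴ * Y v)).trace.re = ∑ p, x p.2 * ‖v p‖ ^ 2 := by
    intro v
    set W : Matrix n n ℂ := of fun i j => v (i, j) with hW
    have : (σ * ((Y v)ᴴ * Y v)).trace = (Wᴴ * (W * diagonal (fun i => (x i : ℂ)))).trace := by
      have : σ * ((Y v)ᴴ * Y v) = (U * diagonal (fun i => (x i : ℂ))) * ((Uᴴ * U) * Wᴴ *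
          (Uᴴ * U) * W * Uᴴ) := by
        conv_lhs => rw [hσU]
        simp only [Y, conjTranspose_mul, conjTranspose_conjTranspose, Matrix.mul_assoc, hW]
      rw [this, trace_mul_comm, h2]
      simp only [Matrix.mul_assoc, Matrix.mul_one, Matrix.one_mul]
      rw [← Matrix.mul_assoc Uᴴ, h2, Matrix.one_mul]
    rw [this, trace_conjTranspose_mul_eq_sum, Complex.re_sum]
    refine Finset.sum_congr rfl fun p _ => ?_
    rw [mul_diagonal, ← mul_assoc, RCLike.star_def, Complex.conj_mul',
      ← Complex.ofReal_pow, ← Complex.ofReal_mul, Complex.ofReal_re, mul_comm]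
    rfl
  have hA1 : ∀ A, ((T * E A)ᴴ * (T * E A)).trace = (σ * (A * Aᴴ)).trace := by
    intro A
    rw [← hE, map_mul, ← hEH, conjTranspose_mul, hTH, ← hTT, ← Matrix.mul_assoc (T * T),
      trace_mul_comm (T * T * E A)]
    simp only [Matrix.mul_assoc]
  have hA2 : ∀ A, ((E A * T)ᴴ * (E A * T)).trace = (σ * (Aᴴ * A)).trace := by
    intro A
    rw [← hE, map_mul, ← hEH, conjTranspose_mul, hTH, ← hTT, Matrix.mul_assoc T T,
      trace_mul_comm T]
    simp only [Matrix.mul_assoc]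
  -- Cauchy–Schwarz for √S E(A) and E(B) √S. Since E is multiplicative and σ is the restriction of S
  -- along E, the squared norms are Tr[σAA*] and Tr[σB*B], which no longer involve S.
  have hcs : ∀ v w : n × n → ℂ, ‖star v ⬝ᵥ G *ᵥ w‖ ^ 2 ≤
      (∑ p, x p.1 * ‖v p‖ ^ 2) * ∑ p, x p.2 * ‖w p‖ ^ 2 := by
    intro v w
    have := norm_trace_conjTranspose_mul_sq_le (T * E (Y v)) (E (Y w) * T)
    rw [← hl, ← hr, hG]
    rw [hA1, hA2] at this
    convert this using 3
    simp only [conjTranspose_mul, hTH, Matrix.mul_assoc]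
  let v : n × n → ℂ := fun p => (Uᴴ * Z * U) p.1 p.2
  have hYv : Y v = Z := by
    have : (of fun i j => v (i, j) : Matrix n n ℂ) = Uᴴ * Z * U := rfl
    simp only [Y, this]
    rw [← Matrix.mul_assoc, ← Matrix.mul_assoc, h1, Matrix.one_mul, Matrix.mul_assoc, h1,
      Matrix.mul_one]
  -- The geometric mean of the weights x_i and x_j is √x_i √x_j, which is precisely the weight in
  -- Tr[Z√σZ√σ].
  have key := re_dotProduct_mulVec_le hGH (fun p => hx p.1) (fun p => hx p.2) hcs v
  rw [hG, hYv, hEH, hZ.eq] at key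
  refine key.trans_eq ?_
  set W : Matrix n n ℂ := Uᴴ * Z * U with hW
  have hWH : Wᴴ = W := by
    rw [hW, conjTranspose_mul, conjTranspose_mul, conjTranspose_conjTranspose, hZ.eq,
      Matrix.mul_assoc]
  set Q : Matrix n n ℂ := diagonal (fun i => ((powFun (1 / 2) (x i) : ℝ) : ℂ)) with hQ
  have : (Z * mpow σ (1 / 2) * Z * mpow σ (1 / 2)).trace = (Wᴴ * (Q * W * Q)).trace := by
    rw [hU, ← Matrix.mul_assoc, trace_mul_comm, hWH, hW]
    simp only [Matrix.mul_assoc, ← hQ]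
  rw [this, trace_conjTranspose_mul_eq_sum, Complex.re_sum]
  refine Finset.sum_congr rfl fun p _ => ?_
  have hsq : ∀ y : ℝ, powFun (1 / 2) y = √y := by
    intro y
    rw [powFun, Real.sqrt_eq_rpow]
    split_ifs with h
    · rw [h, Real.zero_rpow (by norm_num)]
    · rfl
  rw [hQ, mul_diagonal, diagonal_mul, hsq, hsq, Real.sqrt_mul (hx _)]
  have : star (W p.1 p.2) * (((√(x p.1) : ℝ) : ℂ) * W p.1 p.2 * ((√(x p.2) : ℝ) : ℂ)) =
      ((√(x p.1) * √(x p.2) * ‖W p.1 p.2‖ ^ 2 : ℝ) : ℂ) := by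
    push_cast
    rw [← Complex.conj_mul', RCLike.star_def]
    ring
  rw [this, Complex.ofReal_re]

end DataProcessing

/-! ### Marginals and supports -/

section Marginals

variable {X Y : Type*} [Fintype X] [DecidableEq X] [Fintype Y] [DecidableEq Y]

omit [Fintype X] [DecidableEq X] [DecidableEq Y] in
theorem posSemidef_margA {R : Matrix (X × Y) (X × Y) ℂ} (hR : R.PosSemidef) :
    (margA R).PosSemidef := by
  have : margA R = ∑ b, R.submatrix (fun a => (a, b)) (fun a => (a, b)) := by
    ext a a'; simp [margA, Matrix.sum_apply]
  rw [this]
  exact posSemidef_sum _ fun b _ => hR.submatrix _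

omit [Fintype Y] [DecidableEq X] [DecidableEq Y] in
theorem posSemidef_margB {R : Matrix (X × Y) (X × Y) ℂ} (hR : R.PosSemidef) :
    (margB R).PosSemidef := by
  have : margB R = ∑ a, R.submatrix (fun b => (a, b)) (fun b => (a, b)) := by
    ext a a'; simp [margB, Matrix.sum_apply]
  rw [this]
  exact posSemidef_sum _ fun b _ => hR.submatrix _

omit [DecidableEq X] in
theorem trace_mul_kronecker_one (R : Matrix (X × Y) (X × Y) ℂ) (Z : Matrix X X ℂ) :
    (R * (Z ⊗ₖ (1 : Matrix Y Y ℂ))).trace = (margA R * Z).trace := by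
  simp only [trace, diag_apply, mul_apply, Fintype.sum_prod_type, kroneckerMap_apply, one_apply,
    mul_ite, mul_one, mul_zero, Finset.sum_ite_eq', Finset.mem_univ, if_true, margA, of_apply,
    Finset.sum_mul]
  refine Finset.sum_congr rfl fun a _ => ?_
  rw [Finset.sum_comm]

omit [DecidableEq Y] in
theorem trace_mul_one_kronecker (R : Matrix (X × Y) (X × Y) ℂ) (Z : Matrix Y Y ℂ) :
    (R * ((1 : Matrix X X ℂ) ⊗ₖ Z)).trace = (margB R * Z).trace := by
  simp only [trace, diag_apply, mul_apply, Fintype.sum_prod_type, kroneckerMap_apply, one_apply,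
    ite_mul, one_mul, zero_mul, mul_ite, mul_zero, margB, of_apply, Finset.sum_mul]
  rw [Finset.sum_comm]
  refine Finset.sum_congr rfl fun b _ => ?_
  conv_rhs => rw [Finset.sum_comm]
  refine Finset.sum_congr rfl fun a _ => ?_
  rw [Finset.sum_comm]
  simp

theorem trace_margA (R : Matrix (X × Y) (X × Y) ℂ) : (margA R).trace = R.trace := by
  have := trace_mul_kronecker_one R 1
  rw [one_kronecker_one, Matrix.mul_one, Matrix.mul_one] at this
  exact this.symm

theorem trace_margB (R : Matrix (X × Y) (X × Y) ℂ) : (margB R).trace = R.trace := by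
  have := trace_mul_one_kronecker R 1
  rw [one_kronecker_one, Matrix.mul_one, Matrix.mul_one] at this
  exact this.symm

/-- The trace condition says that √ρ(1 - P) has Hilbert–Schmidt norm zero. -/
theorem mul_eq_self_of_trace_mul {n : Type*} [Fintype n] [DecidableEq n] {ρ P : Matrix n n ℂ}
    (hρ : ρ.PosSemidef) (hP : P.IsHermitian) (hPP : P * P = P)
    (h : (ρ * P).trace = ρ.trace) : ρ * P = ρ := by
  set T := mpow ρ (1 / 2) with hT
  have hTT : T * T = ρ := by
    rw [hT, mpow_mul hρ]; norm_num; exact mpow_one hρ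
  have hTH : Tᴴ = T := mpow_conjTranspose hρ _
  have h0 : ((T * (1 - P))ᴴ * (T * (1 - P))).trace = 0 := by
    have e : (T * (1 - P))ᴴ * (T * (1 - P)) = (1 - P) * (ρ * (1 - P)) := by
      rw [conjTranspose_mul, conjTranspose_sub, conjTranspose_one, hP.eq, hTH, ← hTT]
      simp only [Matrix.mul_assoc]
    rw [e, trace_mul_comm, Matrix.mul_assoc]
    have : (1 - P) * (1 - P) = 1 - P := by
      simp [Matrix.mul_sub, Matrix.sub_mul, hPP]
    rw [this, Matrix.mul_sub, trace_sub, h, Matrix.mul_one, sub_self]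
  rw [trace_conjTranspose_mul_self_eq_zero_iff, Matrix.mul_sub, Matrix.mul_one, sub_eq_zero] at h0
  rw [← hTT, Matrix.mul_assoc, ← h0]

/-- The support of a state is contained in that of the product of its marginals. -/
theorem mul_mpow_marginals_zero {ρ : Matrix (X × Y) (X × Y) ℂ} (hρ : ρ.PosSemidef) :
    ρ * mpow (margA ρ ⊗ₖ margB ρ) 0 = ρ := by
  have hA := posSemidef_margA hρ
  have hB := posSemidef_margB hρ
  have h1 : ρ * (mpow (margA ρ) 0 ⊗ₖ (1 : Matrix Y Y ℂ)) = ρ := by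
    refine mul_eq_self_of_trace_mul hρ ?_ ?_ ?_
    · rw [IsHermitian, conjTranspose_kronecker, mpow_conjTranspose hA, conjTranspose_one]
    · rw [← mul_kronecker_mul, mpow_mul hA, Matrix.mul_one, add_zero]
    · rw [trace_mul_kronecker_one, trace_mul_comm, mpow_zero_mul_self hA, trace_margA]
  have h2 : ρ * ((1 : Matrix X X ℂ) ⊗ₖ mpow (margB ρ) 0) = ρ := by
    refine mul_eq_self_of_trace_mul hρ ?_ ?_ ?_
    · rw [IsHermitian, conjTranspose_kronecker, mpow_conjTranspose hB, conjTranspose_one]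
    · rw [← mul_kronecker_mul, mpow_mul hB, Matrix.mul_one, add_zero]
    · rw [trace_mul_one_kronecker, trace_mul_comm, mpow_zero_mul_self hB, trace_margB]
  have h3 : mpow (margA ρ) 0 ⊗ₖ mpow (margB ρ) 0 =
      (mpow (margA ρ) 0 ⊗ₖ (1 : Matrix Y Y ℂ)) * ((1 : Matrix X X ℂ) ⊗ₖ mpow (margB ρ) 0) := by
    rw [← mul_kronecker_mul, Matrix.mul_one, Matrix.one_mul]
  rw [mpow_kronecker hA hB, h3, ← Matrix.mul_assoc, h1, h2]

theorem suppLE_of_mul_mpow_zero {n : Type*} [Fintype n] [DecidableEq n] {ρ σ : Matrix n n ℂ}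
    (hσ : σ.PosSemidef) (h : ρ * mpow σ 0 = ρ) : SuppLE ρ σ := by
  intro v hv
  have : mpow σ 0 = mpow σ (-1) * σ := by
    conv_rhs => rw [← mpow_one hσ, mpow_mpow hσ]
    rw [mpow_mul hσ]; norm_num
  rw [← h, this, ← mulVec_mulVec, ← mulVec_mulVec, hv, mulVec_zero, mulVec_zero]

omit [DecidableEq X] [DecidableEq Y] in
theorem posSemidef_marginals {ρ : Matrix (X × Y) (X × Y) ℂ} (hρ : ρ.PosSemidef) :
    (margA ρ ⊗ₖ margB ρ).PosSemidef :=
  (posSemidef_margA hρ).kronecker (posSemidef_margB hρ)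

end Marginals

/-! ### Pure bipartite states and their Schmidt rank -/

section PureBipartite

variable {a b : Type*} [Fintype a] [DecidableEq a] [Fintype b] [DecidableEq b]

/-- The bipartite vector with coefficient matrix `M`. -/
def coeffVec {a b : Type*} (M : Matrix a b ℂ) : a × b → ℂ := fun p => M p.1 p.2

omit [DecidableEq a] [DecidableEq b] in
theorem kronecker_mulVec_coeffVec (A : Matrix a a ℂ) (B : Matrix b b ℂ) (M : Matrix a b ℂ) :
    (A ⊗ₖ B) *ᵥ coeffVec M = coeffVec (A * M * Bᵀ) := by
  ext ⟨i, j⟩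
  simp only [mulVec, dotProduct, coeffVec, kroneckerMap_apply, Fintype.sum_prod_type_right,
    mul_apply, transpose_apply, Finset.sum_mul]
  refine Finset.sum_congr rfl fun k _ => Finset.sum_congr rfl fun l _ => ?_
  ring

omit [DecidableEq a] [DecidableEq b] in
theorem star_coeffVec_dotProduct (M N : Matrix a b ℂ) :
    star (coeffVec M) ⬝ᵥ coeffVec N = (Mᴴ * N).trace := by
  rw [trace_conjTranspose_mul_eq_sum]
  rfl

omit [DecidableEq b] [Fintype a] [DecidableEq a] in
theorem margA_ketbra_coeffVec (M : Matrix a b ℂ) : margA (ketbra (coeffVec M)) = M * Mᴴ := by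
  ext i j
  simp [margA, ketbra, coeffVec, vecMulVec_apply, mul_apply]

omit [DecidableEq b] [Fintype b] [DecidableEq a] in
theorem margB_ketbra_coeffVec (M : Matrix a b ℂ) : margB (ketbra (coeffVec M)) = (Mᴴ * M)ᵀ := by
  ext i j
  simp [margB, ketbra, coeffVec, vecMulVec_apply, mul_apply, mul_comm]

omit [DecidableEq a] in
theorem trace_ketbra_mul (ψ : a → ℂ) (W : Matrix a a ℂ) :
    (ketbra ψ * W).trace = star ψ ⬝ᵥ W *ᵥ ψ := by
  rw [ketbra, trace_mul_comm, mul_vecMulVec, trace_vecMulVec, dotProduct_comm]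

/-- Powers of the product of the marginals of a pure state act on it as powers of the first
marginal. -/
theorem mpow_marginals_mulVec (M : Matrix a b ℂ) (s t : ℝ) :
    mpow ((M * Mᴴ) ⊗ₖ (Mᴴ * M)ᵀ) s *ᵥ coeffVec (mpow (M * Mᴴ) t * M) =
      coeffVec (mpow (M * Mᴴ) (2 * s + t) * M) := by
  have hA := posSemidef_self_mul_conjTranspose M
  have hB := posSemidef_conjTranspose_mul_self M
  rw [mpow_kronecker hA hB.transpose, kronecker_mulVec_coeffVec, mpow_transpose hB,
    transpose_transpose, ← Matrix.mul_assoc, Matrix.mul_assoc, ← mpow_mul_intertwine,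
    ← Matrix.mul_assoc, mpow_mul hA, mpow_mul hA]
  congr 3
  ring

/-- For a pure state with Schmidt rank `r`: `⟨ψ, W ψ⟩² ≤ r² Tr[W √S W √S]`, with `S` the product
of the marginals. -/
theorem sq_trace_ketbra_mul_le (M : Matrix a b ℂ) {W : Matrix (a × b) (a × b) ℂ}
    (hW : W.IsHermitian) :
    (ketbra (coeffVec M) * W).trace.re ^ 2 ≤ (M.rank : ℝ) ^ 2 *
      (W * mpow ((M * Mᴴ) ⊗ₖ (Mᴴ * M)ᵀ) (1 / 2) * W *
        mpow ((M * Mᴴ) ⊗ₖ (Mᴴ * M)ᵀ) (1 / 2)).trace.re := by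
  have hA := posSemidef_self_mul_conjTranspose M
  have hB := posSemidef_conjTranspose_mul_self M
  have hS := hA.kronecker hB.transpose
  set S := (M * Mᴴ) ⊗ₖ (Mᴴ * M)ᵀ with hSdef
  set T := mpow S (1 / 4) with hT
  have hTT : T * T = mpow S (1 / 2) := by
    rw [hT, mpow_mul hS]; norm_num
  have hTH : Tᴴ = T := mpow_conjTranspose hS _
  -- The coefficient matrix of φ is the partial isometry in the polar decomposition of `M`, so ‖φ‖²
  -- is the rank. The exponent -1/2 is the one cancelled by the fourth root of the product of the
  -- marginals, which acts as (MM*)^{1/2}.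
  set φ := coeffVec (mpow (M * Mᴴ) (-(1 / 2)) * M) with hφ
  have hTφ : T *ᵥ φ = coeffVec M := by
    rw [hT, hφ, hSdef, mpow_marginals_mulVec]
    norm_num [mpow_zero_mul]
  have hφφ : star φ ⬝ᵥ φ = (M.rank : ℂ) := by
    rw [hφ, star_coeffVec_dotProduct, conjTranspose_mul, mpow_conjTranspose hA, trace_mul_comm,
      Matrix.mul_assoc, ← Matrix.mul_assoc M, ← Matrix.mul_assoc, trace_mul_comm,
      ← Matrix.mul_assoc, mpow_mul hA]
    conv_lhs => rw [show (M * Mᴴ) = mpow (M * Mᴴ) 1 from (mpow_one hA).symm]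
    rw [mpow_mpow hA, mpow_mul hA]
    norm_num
    rw [trace_mpow_zero hA, rank_self_mul_conjTranspose]
  have hkb : ketbra (coeffVec M) = T * ketbra φ * T := by
    rw [ketbra, ketbra, mul_vecMulVec, vecMulVec_mul, hTφ]
    congr 1
    rw [← hTφ, star_mulVec, hTH]
  have hkH : (ketbra φ)ᴴ = ketbra φ := by
    rw [ketbra, conjTranspose_vecMulVec, star_star]
  have hcs := norm_trace_conjTranspose_mul_sq_le (ketbra φ) (T * W * T)
  have e1 : ((ketbra φ)ᴴ * (T * W * T)).trace = (ketbra (coeffVec M) * W).trace := by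
    rw [hkb, hkH, ← Matrix.mul_assoc, trace_mul_comm]
    simp only [Matrix.mul_assoc]
  have e2 : ((ketbra φ)ᴴ * ketbra φ).trace.re = (M.rank : ℝ) ^ 2 := by
    rw [hkH, trace_ketbra_mul, ketbra, vecMulVec_mulVec, hφφ]
    simp [dotProduct_smul, hφφ, sq]
  have e3 : ((T * W * T)ᴴ * (T * W * T)).trace = (W * mpow S (1 / 2) * W * mpow S (1 / 2)).trace := by
    rw [conjTranspose_mul, conjTranspose_mul, hTH, hW.eq, ← hTT]
    simp only [Matrix.mul_assoc]
    rw [trace_mul_comm T]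
    simp only [Matrix.mul_assoc]
  rw [e1, e2, e3] at hcs
  refine le_trans ?_ hcs
  rw [← sq_abs]
  gcongr
  exact Complex.abs_re_le_norm _

end PureBipartite

/-! ### Descending from a purification to its reduced state -/

section Purification

variable {X X' Y Y' : Type*} [Fintype X] [DecidableEq X] [Fintype Y] [DecidableEq Y]
  [Fintype X'] [DecidableEq X'] [Fintype Y'] [DecidableEq Y']

/-- The operator `Z ⊗ 1` on the system extended by ancillas on both sides. -/
def ancillaExtend : Matrix (X × Y) (X × Y) ℂ →⋆ₐ[ℂ]
    Matrix ((X × X') × (Y × Y')) ((X × X') × (Y × Y')) ℂ where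
  toFun Z := (Z ⊗ₖ (1 : Matrix (X' × Y') (X' × Y') ℂ)).submatrix
    (Equiv.prodProdProdComm X X' Y Y') (Equiv.prodProdProdComm X X' Y Y')
  map_one' := by rw [one_kronecker_one, submatrix_one_equiv]
  map_mul' A B := by rw [submatrix_mul_equiv, ← mul_kronecker_mul, Matrix.one_mul]
  map_zero' := by rw [zero_kronecker]; rfl
  map_add' A B := by rw [add_kronecker]; rfl
  commutes' r := by
    rw [Algebra.algebraMap_eq_smul_one, Algebra.algebraMap_eq_smul_one, smul_kronecker,
      one_kronecker_one, submatrix_smul, Pi.smul_apply, Pi.smul_apply, submatrix_one_equiv]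
  map_star' A := by
    rw [star_eq_conjTranspose, star_eq_conjTranspose, conjTranspose_submatrix,
      conjTranspose_kronecker, conjTranspose_one]

/-- The partial trace over the ancillas of both sides. -/
def ancillaTrace (R : Matrix ((X × X') × (Y × Y')) ((X × X') × (Y × Y')) ℂ) :
    Matrix (X × Y) (X × Y) ℂ :=
  margA (R.submatrix (Equiv.prodProdProdComm X X' Y Y').symm
    (Equiv.prodProdProdComm X X' Y Y').symm)

theorem trace_mul_ancillaExtend (R : Matrix ((X × X') × (Y × Y')) ((X × X') × (Y × Y')) ℂ)
    (Z : Matrix (X × Y) (X × Y) ℂ) :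
    (R * ancillaExtend Z).trace = (ancillaTrace R * Z).trace := by
  rw [ancillaTrace, ← trace_mul_kronecker_one]
  set e := Equiv.prodProdProdComm X X' Y Y'
  have : R * ancillaExtend Z = (R.submatrix e.symm e.symm *
      (Z ⊗ₖ (1 : Matrix (X' × Y') (X' × Y') ℂ))).submatrix e e := by
    rw [← submatrix_mul_equiv _ _ e e e]
    simp only [submatrix_submatrix, Equiv.symm_comp_self, submatrix_id_id]
    rfl
  rw [this]
  exact Equiv.sum_comp e (R.submatrix e.symm e.symm *
    (Z ⊗ₖ (1 : Matrix (X' × Y') (X' × Y') ℂ))).diag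

omit [Fintype X] [DecidableEq X] [Fintype Y] [DecidableEq Y] [DecidableEq X'] [DecidableEq Y'] in
theorem ancillaTrace_kronecker (P : Matrix (X × X') (X × X') ℂ)
    (Q : Matrix (Y × Y') (Y × Y') ℂ) : ancillaTrace (P ⊗ₖ Q) = margA P ⊗ₖ margA Q := by
  ext ⟨i, j⟩ ⟨k, l⟩
  simp [ancillaTrace, margA, Fintype.sum_prod_type, Finset.sum_mul_sum]

omit [Fintype X] [DecidableEq X] [DecidableEq Y] [DecidableEq X'] [DecidableEq Y'] in
theorem margA_ancillaTrace (R : Matrix ((X × X') × (Y × Y')) ((X × X') × (Y × Y')) ℂ) :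
    margA (ancillaTrace R) = margA (margA R) := by
  ext i j
  simp only [ancillaTrace, margA, Fintype.sum_prod_type, of_apply, submatrix_apply,
    Equiv.prodProdProdComm_symm, Equiv.prodProdProdComm_apply]
  rw [Finset.sum_comm]

omit [DecidableEq X] [Fintype Y] [DecidableEq Y] [DecidableEq X'] [DecidableEq Y'] in
theorem margB_ancillaTrace (R : Matrix ((X × X') × (Y × Y')) ((X × X') × (Y × Y')) ℂ) :
    margB (ancillaTrace R) = margA (margB R) := by
  ext i j
  simp only [ancillaTrace, margA, margB, Fintype.sum_prod_type, of_apply, submatrix_apply,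
    Equiv.prodProdProdComm_symm, Equiv.prodProdProdComm_apply]
  conv_rhs => rw [Finset.sum_comm]
  refine Finset.sum_congr rfl fun a _ => ?_
  rw [Finset.sum_comm]

omit [DecidableEq X'] [DecidableEq Y'] [Fintype X] [Fintype Y] [DecidableEq X] [DecidableEq Y] in
theorem posSemidef_ancillaTrace {R : Matrix ((X × X') × (Y × Y')) ((X × X') × (Y × Y')) ℂ}
    (hR : R.PosSemidef) : (ancillaTrace R).PosSemidef :=
  posSemidef_margA (hR.submatrix _)

/-- If `ρ` has a purification of Schmidt rank `r`, then `Tr[ρ Z]² ≤ r² Tr[Z √σ Z √σ]`, with `σ`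
the product of the marginals of `ρ`. -/
theorem sq_trace_mul_le_of_purification (M : Matrix (X × X') (Y × Y') ℂ)
    {ρ : Matrix (X × Y) (X × Y) ℂ} (hρ : ρ = ancillaTrace (ketbra (coeffVec M)))
    {Z : Matrix (X × Y) (X × Y) ℂ} (hZ : Z.IsHermitian) :
    (ρ * Z).trace.re ^ 2 ≤ (M.rank : ℝ) ^ 2 *
      (Z * mpow (margA ρ ⊗ₖ margB ρ) (1 / 2) * Z *
        mpow (margA ρ ⊗ₖ margB ρ) (1 / 2)).trace.re := by
  have hA := posSemidef_self_mul_conjTranspose M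
  have hB := posSemidef_conjTranspose_mul_self M
  have hS := hA.kronecker hB.transpose
  have hρp : ρ.PosSemidef := by
    rw [hρ]
    exact posSemidef_ancillaTrace (posSemidef_vecMulVec_self_star _)
  have hσ : ancillaTrace ((M * Mᴴ) ⊗ₖ (Mᴴ * M)ᵀ) = margA ρ ⊗ₖ margB ρ := by
    rw [ancillaTrace_kronecker, hρ, margA_ancillaTrace, margB_ancillaTrace,
      margA_ketbra_coeffVec, margB_ketbra_coeffVec]
  have hW : (ancillaExtend (X' := X') (Y' := Y') Z).IsHermitian := by
    rw [IsHermitian, ← star_eq_conjTranspose, ← map_star, star_eq_conjTranspose, hZ.eq]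
  have h1 := sq_trace_ketbra_mul_le M hW
  rw [trace_mul_ancillaExtend, ← hρ] at h1
  refine h1.trans (mul_le_mul_of_nonneg_left ?_ (by positivity))
  exact trace_map_mul_sqrt_le ancillaExtend hS (posSemidef_marginals hρp)
    (fun Z => by rw [trace_mul_ancillaExtend, hσ]) hZ

end Purification

/-! ### From the order-two bound to the divergences -/

section DivergenceBounds

variable {n : Type*} [Fintype n] [DecidableEq n]

/-- The order-two bound `Tr[ρ Z]² ≤ r² Tr[Z √σ Z √σ]` for all observables `Z`, together with
normalization and support conditions. -/
structure OrderTwoBound (ρ σ : Matrix n n ℂ) (r : ℝ) : Prop where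
  posSemidef_left : ρ.PosSemidef
  posSemidef_right : σ.PosSemidef
  trace_re : ρ.trace.re = 1
  mul_mpow_zero : ρ * mpow σ 0 = ρ
  pos : 0 < r
  sq_trace_le : ∀ Z : Matrix n n ℂ, Z.IsHermitian → (ρ * Z).trace.re ^ 2 ≤
    r ^ 2 * (Z * mpow σ (1 / 2) * Z * mpow σ (1 / 2)).trace.re

variable {ρ σ : Matrix n n ℂ} {r : ℝ}

theorem OrderTwoBound.mpow_half_mul (h : OrderTwoBound ρ σ r) :
    mpow ρ (1 / 2) * mpow σ 0 = mpow ρ (1 / 2) := by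
  have hρ := h.posSemidef_left
  have e : mpow ρ (1 / 2) = mpow ρ (-(1 / 2)) * ρ := by
    conv_rhs => rw [← mpow_one hρ, mpow_mpow hρ]
    rw [mpow_mul hρ]; norm_num
  rw [e, Matrix.mul_assoc, h.mul_mpow_zero]

theorem OrderTwoBound.mpow_half_mul_self (h : OrderTwoBound ρ σ r) :
    mpow ρ (1 / 2) * mpow ρ (1 / 2) = ρ := by
  rw [mpow_mul h.posSemidef_left]; norm_num; exact mpow_one h.posSemidef_left

/-- The sandwiched quasi-entropy of order two is at most `r²`. -/
theorem OrderTwoBound.trace_sandwich_le (h : OrderTwoBound ρ σ r) :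
    (ρ * mpow σ (-(1 / 2)) * ρ * mpow σ (-(1 / 2))).trace.re ≤ r ^ 2 := by
  have hρ := h.posSemidef_left
  have hσ := h.posSemidef_right
  set C := mpow σ (-(1 / 2)) with hC
  have hCH : Cᴴ = C := mpow_conjTranspose hσ _
  -- For this observable both sides contain the same trace q, so the bound reads q² ≤ r² q and
  -- yields q ≤ r².
  have hZ : (C * ρ * C).IsHermitian := by
    have := isHermitian_mul_mul_conjTranspose C hρ.1
    rwa [hCH] at this
  have h1 := h.sq_trace_le _ hZ
  have hCT : C * mpow σ (1 / 2) = mpow σ 0 := by rw [hC, mpow_mul hσ]; norm_num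
  have e1 : (ρ * (C * ρ * C)).trace = (ρ * C * ρ * C).trace := by simp only [Matrix.mul_assoc]
  have e2 : (C * ρ * C * mpow σ (1 / 2) * (C * ρ * C) * mpow σ (1 / 2)).trace =
      (ρ * C * ρ * C).trace := by
    have : C * ρ * C * mpow σ (1 / 2) * (C * ρ * C) * mpow σ (1 / 2) =
        C * (ρ * (C * mpow σ (1 / 2)) * C * (ρ * (C * mpow σ (1 / 2)))) := by
      simp only [Matrix.mul_assoc]
    rw [this, hCT, h.mul_mpow_zero, trace_mul_comm]
  rw [e1, e2] at h1
  by_contra! hc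
  have : 0 ≤ r ^ 2 := sq_nonneg r
  nlinarith

/-- Cauchy–Schwarz between √ρ σ^{-1/2} √ρ, whose squared norm is the order-two quasi-entropy, and
√P. This is the endpoint β = 1/2 of the power means. -/
theorem OrderTwoBound.trace_half_le (h : OrderTwoBound ρ σ r) {P : Matrix n n ℂ}
    (hP : P.PosSemidef) : (mpow ρ (1 / 2) * mpow σ (-(1 / 2)) * (mpow ρ (1 / 2))ᴴ *
      mpow P (1 / 2)).trace.re ≤ r * √P.trace.re := by
  have hρ := h.posSemidef_left
  have hσ := h.posSemidef_right
  set T := mpow ρ (1 / 2) with hT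
  have hTH : Tᴴ = T := mpow_conjTranspose hρ _
  have hTT : T * T = ρ := h.mpow_half_mul_self
  set C := mpow σ (-(1 / 2)) with hC
  have hCH : Cᴴ = C := mpow_conjTranspose hσ _
  have hcs := norm_trace_conjTranspose_mul_sq_le (T * C * T) (mpow P (1 / 2))
  have e0 : (T * C * T)ᴴ = T * C * T := by
    rw [conjTranspose_mul, conjTranspose_mul, hTH, hCH, Matrix.mul_assoc]
  have e1 : (T * C * T * (T * C * T)).trace = (ρ * C * ρ * C).trace := by
    have : T * C * T * (T * C * T) = T * (C * (T * T) * C * T) := by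
      simp only [Matrix.mul_assoc]
    rw [this, trace_mul_comm, hTT, Matrix.mul_assoc, hTT, Matrix.mul_assoc, Matrix.mul_assoc,
      trace_mul_comm]
    simp only [Matrix.mul_assoc]
  have e2 : (mpow P (1 / 2))ᴴ * mpow P (1 / 2) = P := by
    rw [mpow_conjTranspose hP, mpow_mul hP]; norm_num; exact mpow_one hP
  rw [e0, e1, e2] at hcs
  have hP0 : 0 ≤ P.trace.re := (Complex.le_def.1 hP.trace_nonneg).1
  rw [hTH]
  refine (Complex.re_le_norm _).trans (abs_le_of_sq_le_sq' ?_ ?_).2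
  · rw [mul_pow, Real.sq_sqrt hP0]
    exact hcs.trans (mul_le_mul_of_nonneg_right h.trace_sandwich_le hP0)
  · exact mul_nonneg h.pos.le (Real.sqrt_nonneg _)

/-- With P = ρ and β = α - 1 the power mean is Tr[ρ^α σ^{1-α}]. The endpoint β = 1/2 is what limits
α to 3/2. -/
theorem OrderTwoBound.petzDiv_le (h : OrderTwoBound ρ σ r) {α : ℝ}
    (hα : α < 1 ∨ 1 < α ∧ α ≤ 3 / 2) : petzDiv α ρ σ ≤ ((2 * Real.log r : ℝ) : EReal) := by
  have hρ := h.posSemidef_left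
  have hσ := h.posSemidef_right
  rw [petzDiv, if_pos (suppLE_of_mul_mpow_zero hσ h.mul_mpow_zero), EReal.coe_le_coe_iff]
  have hTH := mpow_conjTranspose hρ (1 / 2)
  have hF : ∀ b, (mpow ρ (1 / 2) * mpow σ (-b) * (mpow ρ (1 / 2))ᴴ * mpow ρ b).trace =
      (mpow ρ (1 + b) * mpow σ (-b)).trace := by
    intro b
    rw [hTH, Matrix.mul_assoc, mpow_mul hρ, Matrix.mul_assoc, trace_mul_comm, Matrix.mul_assoc,
      mpow_mul hρ, trace_mul_comm]
    ring_nf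
  have h0 : (mpow ρ (1 / 2) * mpow σ 0 * (mpow ρ (1 / 2))ᴴ * mpow ρ 0).trace.re = 1 := by
    have := hF 0
    rw [neg_zero, add_zero, mpow_one hρ, h.mul_mpow_zero] at this
    rw [this, h.trace_re]
  have hR := h.trace_half_le hρ
  rw [h.trace_re, Real.sqrt_one, mul_one] at hR
  have := (inv_mul_log_trace_le hρ hσ _ h0 hR (β := α - 1)
    (by rcases hα with h | h <;> [left; right] <;> [linarith; constructor <;> linarith])).2
  rw [hF] at this
  simpa using this

/-- The power means are applied with P = ω^α and β = (α - 1)/α, where ω = √ρ σ^{-β} √ρ has the same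
traces of powers as the sandwiched operator. Here β ≤ 1/2 means α ≤ 2. -/
theorem OrderTwoBound.sandwichedDiv_le (h : OrderTwoBound ρ σ r) {α : ℝ}
    (hα : (0 < α ∧ α < 1) ∨ (1 < α ∧ α ≤ 2)) :
    sandwichedDiv α ρ σ ≤ ((2 * Real.log r : ℝ) : EReal) := by
  have hρ := h.posSemidef_left
  have hσ := h.posSemidef_right
  rw [sandwichedDiv, if_pos (suppLE_of_mul_mpow_zero hσ h.mul_mpow_zero), EReal.coe_le_coe_iff]
  have hα0 : 0 < α := by rcases hα with h | h <;> linarith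
  have hα1 : α - 1 ≠ 0 := by rcases hα with h | h <;> [exact (by linarith : α - 1 < 0).ne; exact (by linarith : 0 < α - 1).ne']
  set s := (1 - α) / (2 * α) with hs
  set T := mpow ρ (1 / 2) with hT
  have hTH : Tᴴ = T := mpow_conjTranspose hρ _
  have hTT : T * T = ρ := h.mpow_half_mul_self
  set L := T * mpow σ s with hL
  have hLH : Lᴴ = mpow σ s * T := by rw [hL, conjTranspose_mul, hTH, mpow_conjTranspose hσ]
  have hω := posSemidef_self_mul_conjTranspose L
  have hLL : mpow σ s * ρ * mpow σ s = Lᴴ * L := by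
    rw [hLH, hL, ← hTT]; simp only [Matrix.mul_assoc]
  rw [hLL, ← trace_mpow_comm]
  set ω := L * Lᴴ with hωdef
  set β := (α - 1) / α with hβ
  have hβs : s + s = -β := by rw [hs, hβ]; field_simp; ring
  have hω' : T * mpow σ (-β) * Tᴴ = ω := by
    rw [hωdef, hLH, hL, hTH, ← hβs, ← mpow_mul hσ]; simp only [Matrix.mul_assoc]
  have hωT : mpow ω 0 * T = T := by
    have e : T = L * mpow σ (-s) := by
      rw [hL, Matrix.mul_assoc, mpow_mul hσ, add_neg_cancel, h.mpow_half_mul]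
    conv_lhs => rw [e]
    rw [← Matrix.mul_assoc, mpow_zero_mul, ← e]
  have hP := posSemidef_mpow hω α
  have h0 : (T * mpow σ 0 * Tᴴ * mpow (mpow ω α) 0).trace.re = 1 := by
    rw [mpow_mpow hω, mul_zero, h.mpow_half_mul, trace_mul_comm, hTH, ← Matrix.mul_assoc, hωT, hTT,
      h.trace_re]
  have key := inv_mul_log_trace_le hP hσ T h0 (h.trace_half_le hP) (β := β) (by
    rcases hα with h | h
    · left; exact div_neg_of_neg_of_pos (by linarith) hα0
    · right
      refine ⟨div_pos (by linarith) hα0, ?_⟩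
      rw [hβ, div_le_iff₀ hα0]; linarith)
  -- Since αβ + 1 = α, the power mean of ω^α is again Tr ω^α.
  have hF : (T * mpow σ (-β) * Tᴴ * mpow (mpow ω α) β).trace.re = (mpow ω α).trace.re := by
    rw [hω', mpow_mpow hω]
    conv_lhs => rw [← mpow_one hω, mpow_mpow hω]
    rw [mpow_mul hω]
    congr 3
    rw [hβ]; field_simp; ring
  rw [hF] at key
  obtain ⟨hpos, key⟩ := key
  rw [Real.log_mul h.pos.ne' (Real.sqrt_pos.2 hpos).ne', Real.log_sqrt hpos.le] at key
  -- The extra 1 cancels the log Tr ω^α that comes from twice the logarithm of r√(Tr ω^α).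
  have hinv : β⁻¹ = (α - 1)⁻¹ + 1 := by rw [hβ]; field_simp; ring
  rw [hinv] at key
  linarith

theorem trace_mul_re_nonneg {A B : Matrix n n ℂ} (hA : A.PosSemidef) (hB : B.PosSemidef) :
    0 ≤ (A * B).trace.re := by
  have e : (A * B).trace = (mpow B (1 / 2) * A * (mpow B (1 / 2))ᴴ).trace := by
    have : B = mpow B (1 / 2) * mpow B (1 / 2) := by
      rw [mpow_mul hB]; norm_num; exact (mpow_one hB).symm
    conv_lhs => rw [this]
    rw [mpow_conjTranspose hB, ← Matrix.mul_assoc, trace_mul_comm, Matrix.mul_assoc]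
  rw [e]
  exact (Complex.le_def.1 (hA.mul_mul_conjTranspose_same _).trace_nonneg).1

/-- The difference of the two sides is half the squared Hilbert–Schmidt norm of the commutator [Z,
√σ]. -/
theorem trace_mul_sqrt_mul_sqrt_le (hσ : σ.PosSemidef) {Z : Matrix n n ℂ} (hZ : Z.IsHermitian) :
    (Z * mpow σ (1 / 2) * Z * mpow σ (1 / 2)).trace.re ≤ (Z * Z * σ).trace.re := by
  set T := mpow σ (1 / 2) with hT
  have hTH : Tᴴ = T := mpow_conjTranspose hσ _
  have hTT : T * T = σ := by rw [hT, mpow_mul hσ]; norm_num; exact mpow_one hσ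
  have h0 := (Complex.le_def.1 (posSemidef_conjTranspose_mul_self (Z * T - T * Z)).trace_nonneg).1
  have e : ((Z * T - T * Z)ᴴ * (Z * T - T * Z)).trace =
      2 * (Z * Z * σ).trace - 2 * (Z * T * Z * T).trace := by
    have e1 : (Z * T - T * Z)ᴴ * (Z * T - T * Z) =
        T * (Z * Z * T) - T * (Z * T * Z) - Z * T * Z * T + Z * (T * T * Z) := by
      rw [conjTranspose_sub, conjTranspose_mul, conjTranspose_mul, hTH, hZ.eq]
      simp only [Matrix.mul_sub, Matrix.sub_mul, Matrix.mul_assoc]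
      abel
    rw [e1, trace_add, trace_sub, trace_sub, trace_mul_comm T, trace_mul_comm T,
      trace_mul_comm Z (T * T * Z), Matrix.mul_assoc (Z * Z), hTT, Matrix.mul_assoc σ,
      trace_mul_comm σ]
    ring
  rw [e] at h0
  simp only [Complex.zero_re, Complex.sub_re, Complex.mul_re, Complex.re_ofNat,
    Complex.im_ofNat, zero_mul, sub_zero] at h0
  linarith

theorem OrderTwoBound.sq_sum_prob_le (h : OrderTwoBound ρ σ r) {k : ℕ} (M : POVM (Fin k) n)
    (c : Fin k → ℝ) :
    (∑ x, c x * M.prob ρ x) ^ 2 ≤ r ^ 2 * ∑ x, c x ^ 2 * M.prob σ x := by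
  have hσ := h.posSemidef_right
  set Z : Matrix n n ℂ := ∑ x, (c x : ℂ) • M.effect x with hZdef
  have hM : ∀ x, (M.effect x)ᴴ = M.effect x := fun x => (M.posSemidef x).1
  have hZ : Zᴴ = Z := by
    rw [hZdef, conjTranspose_sum]
    refine Finset.sum_congr rfl fun x _ => ?_
    rw [conjTranspose_smul, hM, RCLike.star_def, Complex.conj_ofReal]
  have h1 := h.sq_trace_le Z hZ
  have e1 : (ρ * Z).trace.re = ∑ x, c x * M.prob ρ x := by
    rw [trace_mul_comm, hZdef, Matrix.sum_mul, trace_sum, Complex.re_sum]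
    refine Finset.sum_congr rfl fun x _ => ?_
    rw [Matrix.smul_mul, trace_smul, smul_eq_mul, Complex.re_ofReal_mul]
    rfl
  have e2 : (Z * Z * σ).trace.re ≤ ∑ x, c x ^ 2 * M.prob σ x := by
    -- Summing (c(x) - Z) M(x) (c(x) - Z) ≥ 0 over the outcomes gives the operator inequality Z² ≤ ∑
    -- c(x)² M(x).
    have h2 : ∀ x, 0 ≤ ((((c x : ℂ) • 1 - Z) * M.effect x * ((c x : ℂ) • 1 - Z)) * σ).trace.re := by
      intro x
      refine trace_mul_re_nonneg ?_ hσ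
      have := (M.posSemidef x).mul_mul_conjTranspose_same ((c x : ℂ) • 1 - Z)
      rwa [conjTranspose_sub, hZ, conjTranspose_smul, conjTranspose_one, RCLike.star_def,
        Complex.conj_ofReal] at this
    have h3 : ∑ x, ((c x : ℂ) • 1 - Z) * M.effect x * ((c x : ℂ) • 1 - Z) =
        ∑ x, ((c x : ℂ) ^ 2) • M.effect x - Z * Z := by
      have : ∀ x, ((c x : ℂ) • 1 - Z) * M.effect x * ((c x : ℂ) • 1 - Z) =
          ((c x : ℂ) ^ 2) • M.effect x - ((c x : ℂ) • M.effect x) * Z -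
            Z * ((c x : ℂ) • M.effect x) + Z * M.effect x * Z := by
        intro x
        simp only [Matrix.sub_mul, Matrix.mul_sub, Matrix.smul_mul, Matrix.one_mul,
          Matrix.mul_smul, Matrix.mul_one, sq, smul_smul, smul_sub]
        abel
      simp only [this, Finset.sum_add_distrib, Finset.sum_sub_distrib, ← Matrix.sum_mul,
        ← Matrix.mul_sum, M.sum_eq_one, Matrix.mul_one, ← hZdef]
      abel
    have h4 := Finset.sum_nonneg fun x (_ : x ∈ Finset.univ) => h2 x
    rw [← Complex.re_sum, ← trace_sum, ← Matrix.sum_mul, h3, Matrix.sub_mul, trace_sub,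
      Complex.sub_re, sub_nonneg, Matrix.sum_mul Finset.univ _ σ, trace_sum, Complex.re_sum] at h4
    refine h4.trans_eq (Finset.sum_congr rfl fun x _ => ?_)
    rw [Matrix.smul_mul, trace_smul, smul_eq_mul, ← Complex.ofReal_pow, Complex.re_ofReal_mul]
    rfl
  rw [e1] at h1
  exact h1.trans (mul_le_mul_of_nonneg_left ((trace_mul_sqrt_mul_sqrt_le hσ hZ).trans e2)
    (sq_nonneg r))

/-- The coefficients c = P/Q give the χ² bound ∑ P²/Q ≤ r². It bounds the mean of P/Q under P, and
the power mean of exponent α - 1 gives the rest. -/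
theorem OrderTwoBound.classicalDiv_prob_le (h : OrderTwoBound ρ σ r) {k : ℕ}
    (M : POVM (Fin k) n) {α : ℝ} (hα : (0 < α ∧ α < 1) ∨ (1 < α ∧ α ≤ 2)) :
    classicalDiv α (M.prob ρ) (M.prob σ) ≤ ((2 * Real.log r : ℝ) : EReal) := by
  have hα0 : 0 < α := by rcases hα with h | h <;> linarith
  have hP0 : ∀ x, 0 ≤ M.prob ρ x := fun x =>
    trace_mul_re_nonneg (M.posSemidef x) h.posSemidef_left
  have hQ0 : ∀ x, 0 ≤ M.prob σ x := fun x =>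
    trace_mul_re_nonneg (M.posSemidef x) h.posSemidef_right
  have hP1 : ∑ x, M.prob ρ x = 1 := by
    simp only [POVM.prob]
    rw [← Complex.re_sum, ← trace_sum, ← Matrix.sum_mul, M.sum_eq_one, Matrix.one_mul, h.trace_re]
  have hsq := h.sq_sum_prob_le M
  set P := M.prob ρ
  set Q := M.prob σ
  -- Testing on the indicator of a single outcome gives P(x)² ≤ r² Q(x), so no outcome contributes
  -- ∞.
  have hPQ : ∀ x, P x ≠ 0 → Q x ≠ 0 := by
    intro x hx hQ
    have := hsq (Pi.single x 1)
    simp [Pi.single_apply, hQ] at this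
    exact hx this
  set z : Fin k → ℝ := fun x => if P x = 0 then 1 else P x / Q x with hz
  have hz0 : ∀ x, 0 < z x := by
    intro x
    simp only [hz]
    split_ifs with hx
    · exact one_pos
    · exact div_pos (lt_of_le_of_ne (hP0 x) (Ne.symm hx))
        (lt_of_le_of_ne (hQ0 x) (Ne.symm (hPQ x hx)))
  have hS : ∑ x, P x * z x ≤ r ^ 2 := by
    have h1 := hsq fun x => P x / Q x
    have e1 : ∑ x, P x / Q x * P x = ∑ x, P x * z x := by
      refine Finset.sum_congr rfl fun x _ => ?_
      simp only [hz]
      split_ifs with hx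
      · simp [hx]
      · ring
    have e2 : ∑ x, (P x / Q x) ^ 2 * Q x = ∑ x, P x * z x := by
      refine Finset.sum_congr rfl fun x _ => ?_
      simp only [hz]
      split_ifs with hx
      · simp [hx]
      · field_simp [hPQ x hx]
    rw [e1, e2] at h1
    by_contra! hc
    have : 0 ≤ r ^ 2 := sq_nonneg r
    nlinarith
  have key := inv_mul_log_sum_rpow_le hP0 hP1 hz0 hS (t := α - 1)
    (by rcases hα with h | h <;> [left; right] <;> [linarith; constructor <;> linarith])
  obtain ⟨hpos, key⟩ := key
  have hterm : ∀ x, ENNReal.ofReal (P x) ^ α * ENNReal.ofReal (Q x) ^ (1 - α) =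
      ENNReal.ofReal (P x * z x ^ (α - 1)) := by
    intro x
    simp only [hz]
    split_ifs with hx
    · rw [hx, ENNReal.ofReal_zero, ENNReal.zero_rpow_of_pos hα0, zero_mul, zero_mul,
        ENNReal.ofReal_zero]
    · have h1 := lt_of_le_of_ne (hP0 x) (Ne.symm hx)
      have h2 := lt_of_le_of_ne (hQ0 x) (Ne.symm (hPQ x hx))
      rw [ENNReal.ofReal_rpow_of_pos h1, ENNReal.ofReal_rpow_of_pos h2,
        ← ENNReal.ofReal_mul (by positivity)]
      congr 1
      rw [Real.div_rpow h1.le h2.le, show 1 - α = -(α - 1) by ring, Real.rpow_neg h2.le,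
        Real.rpow_sub_one hx]
      field_simp
  rw [classicalDiv]
  simp only [hterm]
  rw [← ENNReal.ofReal_sum_of_nonneg
      fun x _ => mul_nonneg (hP0 x) (Real.rpow_nonneg (hz0 x).le _),
    ENNReal.log_ofReal_of_pos hpos, ← EReal.coe_mul, EReal.coe_le_coe_iff]
  rw [Real.log_pow] at key
  exact_mod_cast key

theorem OrderTwoBound.measuredDiv_le (h : OrderTwoBound ρ σ r) {α : ℝ}
    (hα : (0 < α ∧ α < 1) ∨ (1 < α ∧ α ≤ 2)) :
    measuredDiv α ρ σ ≤ ((2 * Real.log r : ℝ) : EReal) :=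
  iSup_le fun _ => iSup_le fun M => h.classicalDiv_prob_le M hα

end DivergenceBounds

/-! ### Exact mutual informations of pure states -/

section PureStates

variable {n : Type*} [Fintype n] [DecidableEq n]

omit [Fintype n] [DecidableEq n] in
theorem ketbra_eq_mul (φ : n → ℂ) :
    ketbra φ = replicateCol Unit φ * (replicateCol Unit φ)ᴴ := by
  rw [ketbra, vecMulVec_eq Unit, conjTranspose_replicateCol]

omit [DecidableEq n] in
theorem posSemidef_ketbra (φ : n → ℂ) : (ketbra φ).PosSemidef :=
  posSemidef_vecMulVec_self_star φ

theorem trace_mpow_ketbra {φ : n → ℂ} {c : ℝ} (hφ : star φ ⬝ᵥ φ = (c : ℂ)) (s : ℝ) :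
    (mpow (ketbra φ) s).trace = (powFun s c : ℝ) := by
  have h : (replicateCol Unit φ)ᴴ * replicateCol Unit φ =
      (1 : Matrix Unit Unit ℂ) * diagonal (fun _ => (c : ℂ)) * 1ᴴ := by
    ext i j
    rw [← hφ]
    simp [mul_apply, dotProduct]
  rw [ketbra_eq_mul, trace_mpow_comm, h, mpow_conj_diagonal (by simp) (by simp)]
  simp

theorem mpow_ketbra {φ : n → ℂ} (hφ : star φ ⬝ᵥ φ = 1) (s : ℝ) :
    mpow (ketbra φ) s = ketbra φ := by
  have hP := posSemidef_ketbra φ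
  have h : (replicateCol Unit φ)ᴴ * replicateCol Unit φ =
      (1 : Matrix Unit Unit ℂ) * diagonal (fun _ => ((1 : ℝ) : ℂ)) * 1ᴴ := by
    ext i j
    rw [Complex.ofReal_one, ← hφ]
    simp [mul_apply, dotProduct]
  have h1 : mpow (1 * diagonal (fun _ => ((1 : ℝ) : ℂ)) * 1ᴴ) (s - 1) =
      (1 : Matrix Unit Unit ℂ) := by
    rw [mpow_conj_diagonal (by simp) (by simp)]
    simp [powFun]
  conv_lhs => rw [← sub_add_cancel s 1, ← mpow_mul hP, mpow_one hP, ketbra_eq_mul,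
    ← Matrix.mul_assoc, mpow_mul_intertwine, h, h1, Matrix.mul_one]
  rw [← ketbra_eq_mul]

variable {a b : Type*} [Fintype a] [DecidableEq a] [Fintype b] [DecidableEq b]

theorem mpow_marginals_mulVec_coeffVec (M : Matrix a b ℂ) (s : ℝ) :
    mpow ((M * Mᴴ) ⊗ₖ (Mᴴ * M)ᵀ) s *ᵥ coeffVec M =
      coeffVec (mpow (M * Mᴴ) (2 * s) * M) := by
  have := mpow_marginals_mulVec M s 0
  rwa [mpow_zero_mul, add_zero] at this

omit [DecidableEq b] in
theorem star_coeffVec_dotProduct_mpow (M : Matrix a b ℂ) (s t : ℝ) :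
    star (coeffVec (mpow (M * Mᴴ) s * M)) ⬝ᵥ coeffVec (mpow (M * Mᴴ) t * M) =
      (mpow (M * Mᴴ) (s + t + 1)).trace := by
  have hA := posSemidef_self_mul_conjTranspose M
  have e : mpow (M * Mᴴ) (s + t + 1) = mpow (M * Mᴴ) s * mpow (M * Mᴴ) t * (M * Mᴴ) := by
    rw [← mpow_mul hA, ← mpow_mul hA, mpow_one hA]
  rw [star_coeffVec_dotProduct, conjTranspose_mul, mpow_conjTranspose hA, e, ← Matrix.mul_assoc,
    ← Matrix.mul_assoc, Matrix.mul_assoc Mᴴ, trace_mul_comm _ Mᴴ]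
  simp only [Matrix.mul_assoc]

theorem trace_mpow_eq_ofReal {A : Matrix n n ℂ} (hA : A.PosSemidef) (s : ℝ) :
    (mpow A s).trace = ((mpow A s).trace.re : ℂ) := by
  obtain ⟨U, x, h1, h2, h3, h4, h5, h6⟩ := exists_mpow_eq hA
  rw [trace_mpow h2 (h6 s), Complex.ofReal_re]

theorem suppLE_ketbra_marginals (M : Matrix a b ℂ) :
    SuppLE (ketbra (coeffVec M))
      (margA (ketbra (coeffVec M)) ⊗ₖ margB (ketbra (coeffVec M))) :=
  suppLE_of_mul_mpow_zero (posSemidef_marginals (posSemidef_ketbra _))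
    (mul_mpow_marginals_zero (posSemidef_ketbra _))

/-- Sandwiching keeps the state of rank one, so its α-th power is a scalar power of the squared
norm, which is Tr ρ_A^{4s+1} with 4s + 1 = 2/α - 1. -/
theorem sandwichedMI_ketbra_coeffVec (M : Matrix a b ℂ) (hM : M ≠ 0) {α : ℝ} (h0 : α ≠ 0)
    (h1 : α ≠ 1) : sandwichedMI α (ketbra (coeffVec M)) =
      ((2 * renyiEntropy (2 / α - 1) (margA (ketbra (coeffVec M))) : ℝ) : EReal) := by
  have hA := posSemidef_self_mul_conjTranspose M
  have hA0 : M * Mᴴ ≠ 0 := fun h => hM (self_mul_conjTranspose_eq_zero.1 h)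
  have hS := hA.kronecker (posSemidef_conjTranspose_mul_self M).transpose
  rw [sandwichedMI, sandwichedDiv, if_pos (suppLE_ketbra_marginals M), margA_ketbra_coeffVec,
    margB_ketbra_coeffVec]
  set s := (1 - α) / (2 * α) with hs
  set γ := 2 / α - 1 with hγ
  have e1 : mpow ((M * Mᴴ) ⊗ₖ (Mᴴ * M)ᵀ) s * ketbra (coeffVec M) *
      mpow ((M * Mᴴ) ⊗ₖ (Mᴴ * M)ᵀ) s = ketbra (coeffVec (mpow (M * Mᴴ) (2 * s) * M)) := by
    rw [← mpow_marginals_mulVec_coeffVec, ketbra, ketbra, mul_vecMulVec, vecMulVec_mul,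
      star_mulVec, mpow_conjTranspose hS]
  have e2 := star_coeffVec_dotProduct_mpow M (2 * s) (2 * s)
  rw [trace_mpow_eq_ofReal hA] at e2
  have hγs : 2 * s + 2 * s + 1 = γ := by rw [hs, hγ]; field_simp; ring
  rw [hγs] at e2
  have hpos := trace_mpow_pos hA hA0 γ
  rw [e1, trace_mpow_ketbra e2, Complex.ofReal_re, powFun, if_neg hpos.ne', Real.log_rpow hpos,
    renyiEntropy, EReal.coe_eq_coe_iff]
  have h1' : α - 1 ≠ 0 := sub_ne_zero.2 h1
  have h2 : 1 - γ = 2 * (α - 1) / α := by rw [hγ]; field_simp; ring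
  rw [h2]
  field_simp

/-- A normalized pure state equals its own powers, so the trace is the expectation of σ^{1-α} in ψ,
namely Tr ρ_A^{1+2(1-α)}. -/
theorem petzMI_ketbra_coeffVec (M : Matrix a b ℂ)
    (hM : star (coeffVec M) ⬝ᵥ coeffVec M = 1) (α : ℝ) :
    petzMI α (ketbra (coeffVec M)) =
      ((2 * renyiEntropy (3 - 2 * α) (margA (ketbra (coeffVec M))) : ℝ) : EReal) := by
  rw [petzMI, petzDiv, if_pos (suppLE_ketbra_marginals M), margA_ketbra_coeffVec,
    margB_ketbra_coeffVec, mpow_ketbra hM, trace_ketbra_mul, mpow_marginals_mulVec_coeffVec]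
  have e := star_coeffVec_dotProduct_mpow M 0 (2 * (1 - α))
  rw [mpow_zero_mul, show 0 + 2 * (1 - α) + 1 = 3 - 2 * α by ring] at e
  rw [e, renyiEntropy, EReal.coe_eq_coe_iff, show 1 - (3 - 2 * α) = 2 * (α - 1) by ring, mul_inv]
  ring

end PureStates

/-! ### Lattice cuts and PEPS bond counting -/

section Lattice

variable {V : Type*} [Fintype V] [DecidableEq V]

/-- The coefficient matrix of a vector of all the sites with respect to the bipartition
`A`, `Aᶜ`. -/
def cutMatrix {P : Type*} (A : Finset V) (ψ : (V → P) → ℂ) :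
    Matrix ({v // v ∈ A} → P) ({v // v ∉ A} → P) ℂ :=
  of fun s t => ψ ((Equiv.piEquivPiSubtypeProd (fun v => v ∈ A) (fun _ => P)).symm (s, t))

omit [Fintype V] in
theorem bipartite_ketbra {d : ℕ} (A : Finset V) (ψ : (V → Fin d) → ℂ) :
    bipartite A (ketbra ψ) = ketbra (coeffVec (cutMatrix A ψ)) := rfl

theorem star_coeffVec_cutMatrix {d : ℕ} (A : Finset V) {ψ : (V → Fin d) → ℂ}
    (hψ : ∑ s, ‖ψ s‖ ^ 2 = 1) :
    star (coeffVec (cutMatrix A ψ)) ⬝ᵥ coeffVec (cutMatrix A ψ) = 1 := by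
  have h : star (coeffVec (cutMatrix A ψ)) ⬝ᵥ coeffVec (cutMatrix A ψ) = ∑ s, star (ψ s) * ψ s :=
    Equiv.sum_comp (Equiv.piEquivPiSubtypeProd (fun v => v ∈ A) (fun _ => Fin d)).symm
      fun s => star (ψ s) * ψ s
  rw [h, ← Complex.ofReal_one, ← hψ]
  push_cast
  exact Finset.sum_congr rfl fun s _ => Complex.conj_mul' _

/-- The coefficient matrix of a vector with physical and ancilla indices. -/
def cutMatrixAncilla {d : ℕ} (A : Finset V) (ψ : (V → Fin d × Fin d) → ℂ) :
    Matrix (({v // v ∈ A} → Fin d) × ({v // v ∈ A} → Fin d))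
      (({v // v ∉ A} → Fin d) × ({v // v ∉ A} → Fin d)) ℂ :=
  (cutMatrix A ψ).submatrix (fun p v => (p.1 v, p.2 v)) (fun p v => (p.1 v, p.2 v))

theorem bipartite_traceAncilla {d : ℕ} (A : Finset V) (ψ : (V → Fin d × Fin d) → ℂ) :
    bipartite A (traceAncilla (ketbra ψ)) =
      ancillaTrace (ketbra (coeffVec (cutMatrixAncilla A ψ))) := by
  set e := Equiv.piEquivPiSubtypeProd (fun v => v ∈ A) (fun _ => Fin d) with he
  set e' := Equiv.piEquivPiSubtypeProd (fun v => v ∈ A) (fun _ => Fin d × Fin d) with he'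
  have hpair : ∀ p q, (fun v => (e.symm p v, e.symm q v)) =
      e'.symm (fun v => (p.1 v, q.1 v), fun v => (p.2 v, q.2 v)) := by
    intro p q
    ext v : 1
    simp only [he, he', Equiv.piEquivPiSubtypeProd_symm_apply]
    split_ifs <;> rfl
  ext p q
  simp only [bipartite, reindex_apply, submatrix_apply, traceAncilla, of_apply]
  rw [← Equiv.sum_comp e.symm]
  simp only [ancillaTrace, margA, of_apply, submatrix_apply]
  refine Finset.sum_congr rfl fun t _ => ?_
  rw [← he, hpair, hpair]
  rfl

open Classical in
/-- Across a cut, a PEPS vector factors through the virtual indices of the cut edges. -/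
theorem exists_cutMatrix_vector_eq_mul {G : SimpleGraph V} [DecidableRel G.Adj] {D : ℕ}
    {P : Type*} (T : PEPS G D P) (A : Finset V) :
    ∃ (F : Matrix ({v // v ∈ A} → P)
        ({e : G.edgeSet // (∃ v ∈ A, v ∈ e.1) ∧ ∃ v, v ∉ A ∧ v ∈ e.1} → Fin D) ℂ)
      (H : Matrix ({e : G.edgeSet // (∃ v ∈ A, v ∈ e.1) ∧ ∃ v, v ∉ A ∧ v ∈ e.1} → Fin D)
        ({v // v ∉ A} → P) ℂ), cutMatrix A T.vector = F * H := by
  -- Tensors in `A` see only edges that meet `A`. Tensors outside see such edges only through the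
  -- cut, so `F` sums over edge values with a prescribed restriction to the cut, and `g` over the
  -- edges that avoid `A`.
  let E₁ : G.edgeSet → Prop := fun e => ∃ v ∈ A, v ∈ e.1
  let C : Type _ := {e : G.edgeSet // (∃ v ∈ A, v ∈ e.1) ∧ ∃ v, v ∉ A ∧ v ∈ e.1}
  let res : ({e // E₁ e} → Fin D) → C → Fin D := fun b c => b ⟨c.1, c.2.1⟩
  let f : ({e // E₁ e} → Fin D) → ({v // v ∈ A} → P) → ℂ := fun b s =>
    ∏ v : {v // v ∈ A}, T v.1 (fun e => b ⟨⟨e.1, e.2.1⟩, v.1, v.2, e.2.2⟩) (s v)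
  let g : (C → Fin D) → ({v // v ∉ A} → P) → ℂ := fun c t =>
    ∑ b : {e // ¬ E₁ e} → Fin D, ∏ v : {v // v ∉ A}, T v.1
      (fun e => if h : E₁ ⟨e.1, e.2.1⟩ then c ⟨⟨e.1, e.2.1⟩, h, v.1, v.2, e.2.2⟩
        else b ⟨⟨e.1, e.2.1⟩, h⟩) (t v)
  refine ⟨of fun s c => ∑ b, if res b = c then f b s else 0, of g, ?_⟩
  ext s t
  have h1 : cutMatrix A T.vector s t = ∑ b, f b s * g (res b) t := by
    simp only [cutMatrix, of_apply, PEPS.vector]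
    rw [← Equiv.sum_comp (Equiv.piEquivPiSubtypeProd E₁ (fun _ => Fin D)).symm,
      Fintype.sum_prod_type]
    refine Finset.sum_congr rfl fun b₁ _ => ?_
    simp only [g, Finset.mul_sum]
    refine Finset.sum_congr rfl fun b₂ _ => ?_
    rw [← Fintype.prod_subtype_mul_prod_subtype (fun v => v ∈ A)]
    congr 1
    · refine Finset.prod_congr (by ext; simp) fun v _ => ?_
      congr 1
      · ext e : 1
        have : E₁ ⟨e.1, e.2.1⟩ := ⟨v.1, v.2, e.2.2⟩
        simp only [Equiv.piEquivPiSubtypeProd_symm_apply, this, dif_pos]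
      · simp only [Equiv.piEquivPiSubtypeProd_symm_apply, v.2, dif_pos]
    · refine Finset.prod_congr (by ext; simp) fun v _ => ?_
      congr 1
      simp only [Equiv.piEquivPiSubtypeProd_symm_apply, v.2, dif_neg, not_false_eq_true]
  rw [h1, mul_apply]
  simp only [of_apply, Finset.sum_mul, ite_mul, zero_mul]
  rw [Finset.sum_comm]
  refine Finset.sum_congr rfl fun b _ => ?_
  simp

open Classical in
-- The pairs counted by `interedges` are ordered, but their first vertex lies in `A` and their
-- second outside, so no bond is counted twice. A surjection onto the cut edges is enough here.
theorem card_cutEdges_le (G : SimpleGraph V) [DecidableRel G.Adj] (A : Finset V) :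
    Fintype.card {e : G.edgeSet // (∃ v ∈ A, v ∈ e.1) ∧ ∃ v, v ∉ A ∧ v ∈ e.1} ≤
      (G.interedges A Aᶜ).card := by
  rw [← Fintype.card_coe]
  have hm : ∀ p : G.interedges A Aᶜ, p.1.1 ∈ A ∧ p.1.2 ∈ Aᶜ ∧ G.Adj p.1.1 p.1.2 := fun p =>
    G.mem_interedges_iff.1 p.2
  refine Fintype.card_le_of_surjective
    (fun p : G.interedges A Aᶜ => ⟨⟨s(p.1.1, p.1.2), (hm p).2.2⟩,
      ⟨p.1.1, (hm p).1, Sym2.mem_mk_left _ _⟩,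
      ⟨p.1.2, Finset.mem_compl.1 (hm p).2.1, Sym2.mem_mk_right _ _⟩⟩) ?_
  rintro ⟨⟨e, he⟩, ⟨v, hv, hve⟩, w, hw, hwe⟩
  have hvw : v ≠ w := fun h => hw (h ▸ hv)
  obtain rfl : e = s(v, w) := (Sym2.mem_and_mem_iff hvw).1 ⟨hve, hwe⟩
  exact ⟨⟨(v, w), G.mem_interedges_iff.2 ⟨hv, Finset.mem_compl.2 hw, he⟩⟩, rfl⟩

theorem log_rank_cutMatrixAncilla_le {G : SimpleGraph V} [DecidableRel G.Adj] {d D : ℕ}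
    (T : PEPS G D (Fin d × Fin d)) (A : Finset V) (h0 : 0 < (cutMatrixAncilla A T.vector).rank) :
    Real.log (cutMatrixAncilla A T.vector).rank ≤
      ((G.interedges A Aᶜ).card : ℝ) * Real.log D := by
  classical
  obtain ⟨F, H, hFH⟩ := exists_cutMatrix_vector_eq_mul T A
  have hM : cutMatrixAncilla A T.vector =
      F.submatrix (fun p v => (p.1 v, p.2 v)) id * H.submatrix id (fun p v => (p.1 v, p.2 v)) := by
    rw [cutMatrixAncilla, hFH, submatrix_mul _ _ _ id _ Function.bijective_id]
  have h1 : (cutMatrixAncilla A T.vector).rank ≤ D ^ Fintype.card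
      {e : G.edgeSet // (∃ v ∈ A, v ∈ e.1) ∧ ∃ v, v ∉ A ∧ v ∈ e.1} := by
    rw [hM]
    refine (rank_mul_le_left _ _).trans ((rank_le_card_width _).trans_eq ?_)
    simp
  have h2 : Real.log (cutMatrixAncilla A T.vector).rank ≤ Real.log ((D : ℝ) ^ Fintype.card
      {e : G.edgeSet // (∃ v ∈ A, v ∈ e.1) ∧ ∃ v, v ∉ A ∧ v ∈ e.1}) :=
    Real.log_le_log (by exact_mod_cast h0) (by exact_mod_cast h1)
  rw [Real.log_pow] at h2
  refine h2.trans (mul_le_mul_of_nonneg_right ?_ (Real.log_natCast_nonneg D))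
  exact_mod_cast card_cutEdges_le G A

theorem exists_orderTwoBound {G : SimpleGraph V} [DecidableRel G.Adj] {d D : ℕ}
    {ρ : Matrix (V → Fin d) (V → Fin d) ℂ} (hρ : IsLocallyPurifiedPEPDO G d D ρ) (A : Finset V) :
    ∃ r : ℝ, OrderTwoBound (bipartite A ρ)
      (margA (bipartite A ρ) ⊗ₖ margB (bipartite A ρ)) r ∧
      2 * Real.log r ≤ 2 * ((G.interedges A Aᶜ).card : ℝ) * Real.log D := by
  obtain ⟨htr, T, hT⟩ := hρ
  have hb := bipartite_traceAncilla A T.vector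
  rw [← hT] at hb
  have htr' : (bipartite A ρ).trace = 1 := by
    rw [← htr]
    exact Equiv.sum_comp (Equiv.piEquivPiSubtypeProd (fun v => v ∈ A) (fun _ => Fin d)).symm
      ρ.diag
  have hpsd : (bipartite A ρ).PosSemidef := by
    rw [hb]
    exact posSemidef_ancillaTrace (posSemidef_ketbra _)
  have hH := fun Z hZ => sq_trace_mul_le_of_purification (cutMatrixAncilla A T.vector) hb
    (Z := Z) hZ
  -- Rank zero would contradict the quadratic bound at Z = 1, whose left side is (Tr ρ)² = 1.
  have hr : 0 < (cutMatrixAncilla A T.vector).rank := by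
    by_contra! h
    have h1 := hH 1 isHermitian_one
    rw [Nat.le_zero.1 h, Matrix.mul_one, htr'] at h1
    norm_num at h1
  refine ⟨(cutMatrixAncilla A T.vector).rank, ⟨hpsd, posSemidef_marginals hpsd, by rw [htr']; simp,
    mul_mpow_marginals_zero hpsd, by exact_mod_cast hr, hH⟩, ?_⟩
  have := log_rank_cutMatrixAncilla_le T A hr
  linarith

end Lattice

end RenyiMI

end

theorem theorem5 {V : Type*} [Fintype V] [DecidableEq V] (G : SimpleGraph V) [DecidableRel G.Adj]
    (d D : ℕ) (A : Finset V) :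
    (∀ ρ : Matrix (V → Fin d) (V → Fin d) ℂ, RenyiMI.IsLocallyPurifiedPEPDO G d D ρ →
      (∀ α : ℝ, (0 < α ∧ α < 1) ∨ (1 < α ∧ α ≤ 2) →
        RenyiMI.measuredMI α (RenyiMI.bipartite A ρ) ≤
          ((2 * ((G.interedges A Aᶜ).card : ℝ) * Real.log (D : ℝ) : ℝ) : EReal)) ∧
      (∀ α : ℝ, (1 / 2 ≤ α ∧ α < 1) ∨ (1 < α ∧ α ≤ 2) →
        RenyiMI.sandwichedMI α (RenyiMI.bipartite A ρ) ≤
          ((2 * ((G.interedges A Aᶜ).card : ℝ) * Real.log (D : ℝ) : ℝ) : EReal)) ∧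
      (∀ α : ℝ, (0 < α ∧ α < 1) ∨ (1 < α ∧ α ≤ 3 / 2) →
        RenyiMI.petzMI α (RenyiMI.bipartite A ρ) ≤
          ((2 * ((G.interedges A Aᶜ).card : ℝ) * Real.log (D : ℝ) : ℝ) : EReal))) ∧
    (∀ ψ : (V → Fin d) → ℂ, ∑ s, ‖ψ s‖ ^ 2 = 1 →
      (∀ α : ℝ, (0 < α ∧ α < 1) ∨ (1 < α ∧ α < 2) →
        RenyiMI.sandwichedMI α (RenyiMI.bipartite A (RenyiMI.ketbra ψ)) =
          ((2 * RenyiMI.renyiEntropy (2 / α - 1)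
            (RenyiMI.margA (RenyiMI.bipartite A (RenyiMI.ketbra ψ))) : ℝ) : EReal)) ∧
      (∀ α : ℝ, (0 < α ∧ α < 1) ∨ (1 < α ∧ α < 3 / 2) →
        RenyiMI.petzMI α (RenyiMI.bipartite A (RenyiMI.ketbra ψ)) =
          ((2 * RenyiMI.renyiEntropy (3 - 2 * α)
            (RenyiMI.margA (RenyiMI.bipartite A (RenyiMI.ketbra ψ))) : ℝ) : EReal))) := by
  refine ⟨fun ρ hρ => ?_, fun ψ hψ => ?_⟩
  · obtain ⟨r, h, hr⟩ := RenyiMI.exists_orderTwoBound hρ A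
    have hr' := EReal.coe_le_coe_iff.2 hr
    refine ⟨fun α hα => (h.measuredDiv_le hα).trans hr',
      fun α hα => (h.sandwichedDiv_le ?_).trans hr', fun α hα => (h.petzDiv_le ?_).trans hr'⟩
    · exact hα.imp (fun h => ⟨by linarith, h.2⟩) id
    · exact hα.imp (fun h => h.2) id
  · rw [RenyiMI.bipartite_ketbra]
    have h1 := RenyiMI.star_coeffVec_cutMatrix A hψ
    have h0 : RenyiMI.cutMatrix A ψ ≠ 0 := by
      intro h
      rw [RenyiMI.star_coeffVec_dotProduct, h] at h1
      simp at h1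
    refine ⟨fun α hα => RenyiMI.sandwichedMI_ketbra_coeffVec _ h0 ?_ ?_,
      fun α _ => RenyiMI.petzMI_ketbra_coeffVec _ h1 α⟩
    · rcases hα with h | h <;> linarith
    · rcases hα with h | h <;> [exact h.2.ne; exact h.1.ne']
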